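/- Let $(\mathcal X,\mathcal S,\mu)$ be a probability space. A measure preserving map $T:\mathcal X\to\mathcal X$ is *weak mixing* if $\lim_{n\to\infty}\frac1n\sum_{i=0}^{n-1}|\mu(A\cap T^{-i}B)-\mu(A)\mu(B)|=0$ for all $A,B\in\mathcal S$. For $C_1,\dots,C_n\in\mathcal S$ let $\vee_{i=1}^n C_i$ be the partition of $\mathcal X$ into the non-empty sets $\tilde C_1\cap\dots\cap\tilde C_n$ with $\tilde C_i\in\{C_i,C_i^c\}$, and let $H(\Pi)=-\sum_{A\in\Pi}\mu(A)\log_2\mu(A)$ (with $0\log_2 0=0$) be the entropy of a finite partition $\Pi$. The entropy of a family $\mathcal C\subseteq\mathcal S$ is $$H(\mathcal C)=\sup_{(C_1,C_2,\dots)}\ \liminf_{n\to\infty}\frac1n H\big(\vee_{i=1}^n C_i\big),$$ the supremum being over all sequences of sets in $\mathcal C$ (and $H(\emptyset)=0$). Let $\Phi$ be the set of invertible measure preserving transformations $\phi$ of $(\mathcal X,\mathcal S,\mu)$ (bijections, measurable in both directions; transformations that agree almost everywhere are identified), with the weak topology: $\phi_r\to\phi$ if and only if $\mu(\phi_rA\,\triangle\,\phi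 A)\to0$ for every $A\in\mathcal S$. For a measure preserving transformation $T$ and $\phi\in\Phi$ put $T_\phi=\phi^{-1}\circ T\circ\phi$. A probability space is *Lebesgue* if, modulo null sets, it is isomorphic to $\mathbb R$ with a Borel probability measure, or with the completion of one (equivalently, to an interval with Lebesgue measure, on the Borel or on the Lebesgue $\sigma$-algebra, together with at most countably many atoms). **Corollary.** Let $T$ be a weak mixing transformation of a probability space $(\mathcal X,\mathcal S,\mu)$ and let $\mathcal C\subseteq\mathcal S$. (i) If $H(\mathcal C)=0$, then $T$ is uniformly weak mixing on $\mathcal C$: $$\lim_{n\to\infty}\ \sup_{A,B\in\mathcal C}\ \frac1n\sum_{i=0}^{n-1}\big|\mu(A\cap T^{-i}B)-\mu(A)\mu(B)\big|=0.$$ (ii) Suppose that $T$ is invertible, that is, equal almost everywhere to an element of $\Phi$, and that $(\mathcal X,\mathcal S,\mu)$ is Lebesgue. If $H(\mathcal C)>0$, then there is a dense $G_\delta$ set $G\subseteq\Phi$ such that for every $\phi\in G$ $$\limsup_{n\to\infty}\ \sup_{C\in\mathcal C}\ \frac1n\sum_{i=0}^{n-1}\big|\mu(C\cap T_\phi^{-i}C)-\mu(C)^2\big|>0.$$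 -/

import Mathlib

open MeasureTheory Filter Topology

open scoped symmDiff

noncomputable section

namespace UniformMixing

variable {X : Type*} [MeasurableSpace X]

/-- The base-2 Shannon entropy `-∑ μ(A) log₂ μ(A)` of a finite partition of `X`, given as an
indexed family of cells. Null cells contribute `0`. -/
def partitionEntropy {ι : Type*} [Fintype ι] (μ : Measure X) (P : ι → Set X) : ℝ :=
  -∑ i, μ.real (P i) * Real.logb 2 (μ.real (P i))

/-- The cells of the join of `n` sets `C 0, …, C (n - 1)`: the cell with index `σ` is the
intersection of the sets `C i` with `σ i = true` and the complements of those with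
`σ i = false`. Cells with distinct indices are disjoint. -/
def joinCell {n : ℕ} (C : Fin n → Set X) (σ : Fin n → Bool) : Set X :=
  ⋂ i, if σ i then C i else (C i)ᶜ

/-- Entropy of a sequence of sets: `liminf (1/n) H(C 0 ∨ … ∨ C (n - 1))`.
The sequence lies between `0` and `1`. -/
def sequenceEntropy (μ : Measure X) (C : ℕ → Set X) : ℝ :=
  liminf (fun n : ℕ => partitionEntropy μ (joinCell fun i : Fin n => C i) / n) atTop

/-- Entropy of a family of sets: the supremum of the entropies of all sequences of members
(with repetitions allowed). The supremum is over a set of reals bounded by `1`, and is `0` for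
the empty family. -/
def familyEntropy (μ : Measure X) (𝒞 : Set (Set X)) : ℝ :=
  ⨆ S : ℕ → 𝒞, sequenceEntropy μ fun i => (S i : Set X)

/-- The Cesàro average `(1/n) ∑_{i<n} |μ(A ∩ T⁻ⁱB) - μ(A)μ(B)|`. -/
def mixingAverage (μ : Measure X) (T : X → X) (A B : Set X) (n : ℕ) : ℝ :=
  (∑ i ∈ Finset.range n, |μ.real (A ∩ T^[i] ⁻¹' B) - μ.real A * μ.real B|) / n

/-- A weak mixing measure preserving transformation. -/
structure IsWeakMixing (μ : Measure X) (T : X → X) : Prop where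
  measurePreserving : MeasurePreserving T μ μ
  tendsto_mixingAverage : ∀ A B : Set X, MeasurableSet A → MeasurableSet B →
    Tendsto (mixingAverage μ T A B) atTop (𝓝 0)

/-- The invertible measure preserving transformations of `(X, μ)`. Almost everywhere equal
transformations are not distinguished by the topology below, so that the dense `G_δ` sets here
are exactly the preimages of those of the quotient by almost everywhere equality. -/
def Automorphisms (μ : Measure X) : Type _ :=
  {φ : X ≃ᵐ X // MeasurePreserving φ μ μ}

/-- The image of a measurable set under an automorphism, as a point of the space of measurable
sets with the pseudodistance `μ(A ∆ B)`. -/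
def Automorphisms.image {μ : Measure X} (φ : Automorphisms μ) (A : {A : Set X // MeasurableSet A}) :
    MeasuredSets μ :=
  ⟨φ.1 '' (A : Set X), φ.1.measurableSet_image.2 A.2⟩

/-- The weak topology: the topology of pointwise convergence of the maps `A ↦ φA` on measurable
sets, so that `φ_r → φ` means `μ(φ_r A ∆ φA) → 0` for all measurable `A`. -/
instance (μ : Measure X) : TopologicalSpace (Automorphisms μ) :=
  TopologicalSpace.induced Automorphisms.image Pi.topologicalSpace

/-- A transformation is invertible if it agrees almost everywhere with an invertible measure
preserving transformation. -/
def IsInvertible (μ : Measure X) (T : X → X) : Prop :=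
  ∃ τ : Automorphisms μ, T =ᵐ[μ] τ.1

/-- The conjugate `T_φ = φ⁻¹ ∘ T ∘ φ`. -/
def conjugate {μ : Measure X} (T : X → X) (φ : Automorphisms μ) : X → X :=
  φ.1.symm ∘ T ∘ φ.1

/-- Isomorphism modulo null sets of measure spaces. -/
def IsIsomorphicModNull {Y : Type*} [MeasurableSpace Y] (μ : Measure X) (ν : Measure Y) : Prop :=
  ∃ (X₀ : Set X) (Y₀ : Set Y), MeasurableSet X₀ ∧ MeasurableSet Y₀ ∧ μ X₀ᶜ = 0 ∧ ν Y₀ᶜ = 0 ∧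
    ∃ e : X₀ ≃ᵐ Y₀,
      MeasurePreserving e (μ.comap (Subtype.val : X₀ → X)) (ν.comap (Subtype.val : Y₀ → Y))

/-- A Lebesgue probability space: one that is isomorphic modulo null sets to the real line with a
Borel probability measure or with the completion of one. Both usual conventions about the
`σ`-algebra (Borel, or complete) are covered. Up to isomorphism such a measure is Lebesgue measure
on an interval together with countably many atoms; atoms are allowed. -/
def IsLebesgueSpace (μ : Measure X) : Prop :=
  ∃ ν : Measure ℝ, IsProbabilityMeasure ν ∧
    (IsIsomorphicModNull μ ν ∨ IsIsomorphicModNull μ ν.completion)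

end UniformMixing

end

/-! Both parts rest on one dichotomy. Measure how badly a set C cuts a finite partition by its split
size, the sum over cells R of min(μ(R ∩ C), μ(R \ C)). Adjoining C raises the entropy by at least
the split size, and by at most the binary entropy h(c) if the split size is at most c ≤ 1/2. Hence,
if 𝒞 has entropy zero, for each c > 0 a finite join of members approximates all of 𝒞 within c
(`familyEntropy_pos`); if the entropy is positive, there is c > 0 such that every finite partition
is cut by at least c by some member (`exists_splitSize_of_familyEntropy_pos`).

Part (i): the mixing average is Lipschitz in both sets, uniformly in n, so uniformity over 𝒞 reduces
to the finitely many unions of cells of one partition.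

Part (ii): conjugating T by φ amounts to replacing C by φC. Fix a time n, an automorphism φ and a
finite partition whose images must not change. Weak mixing supplies a set F that is almost invariant
and nearly independent of the partition (`IsWeakMixing.exists_almostInvariant`). For a member C that
cuts the partition, φC can be rearranged inside the cells into a set E which, cell by cell, nearly
contains F or is nearly contained in it (`exists_rearrangement`). Then E and F are correlated by a
fixed amount, and as F hardly moves in n steps, Cauchy–Schwarz bounds the mixing average of E at
time n from below (`sq_le_two_mul_mixingAverage`).

Iterating this for n = 1, 2, … while freezing more and more sets gives a sequence of automorphisms;
a real coordinate on the Lebesgue space makes it converge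
(`IsCoordinate.exists_limit_automorphism`). The limit mixes badly at every time and agrees with the
initial φ on prescribed sets. This proves density directly, without a category argument; the G_δ
property follows from continuity of φ ↦ φC. -/

namespace UniformMixing

/-! ### Entropy inequalities for two masses, and cells of a join -/

variable {X : Type*}

/-- From log t ≥ 1 - 1/t, splitting a mass x + y gains at least 2xy/(x + y), which is at least the
smaller piece. -/
lemma negMulLog_add_ge {x y : ℝ} (hx : 0 ≤ x) (hy : 0 ≤ y) :
    Real.negMulLog (x + y) + min x y ≤ Real.negMulLog x + Real.negMulLog y := by
  rcases hx.eq_or_lt with rfl | hx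
  · simp [hy]
  rcases hy.eq_or_lt with rfl | hy
  · simp [hx.le]
  have h1 : 1 - x / (x + y) ≤ Real.log ((x + y) / x) := by
    have := Real.one_sub_inv_le_log_of_pos (show 0 < (x + y) / x by positivity)
    simpa using this
  have h2 : 1 - y / (x + y) ≤ Real.log ((x + y) / y) := by
    have := Real.one_sub_inv_le_log_of_pos (show 0 < (x + y) / y by positivity)
    simpa using this
  rw [Real.log_div (by positivity) (by positivity)] at h1 h2
  have h3 : min x y ≤ x * (1 - x / (x + y)) + y * (1 - y / (x + y)) := by
    have : x * (1 - x / (x + y)) + y * (1 - y / (x + y)) = 2 * x * y / (x + y) := by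
      field_simp; ring
    rw [this, le_div_iff₀ (by positivity)]
    rcases le_total x y with h | h
    · rw [min_eq_left h]; nlinarith
    · rw [min_eq_right h]; nlinarith
  have h4 := mul_le_mul_of_nonneg_left h1 hx.le
  have h5 := mul_le_mul_of_nonneg_left h2 hy.le
  simp only [Real.negMulLog]
  nlinarith

lemma negMulLog_add_le {x y : ℝ} (hx : 0 ≤ x) (hy : 0 ≤ y) :
    Real.negMulLog (x + y) ≤ Real.negMulLog x + Real.negMulLog y := by
  have := negMulLog_add_ge hx hy
  have := le_min hx hy
  linarith

/-- The two-point Gibbs inequality. -/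
lemma negMulLog_add_gibbs {x y a b : ℝ} (hx : 0 ≤ x) (hy : 0 ≤ y) (ha : 0 < a) (hb : 0 < b)
    (hab : a + b = 1) :
    Real.negMulLog x + Real.negMulLog y ≤
      Real.negMulLog (x + y) + (x * Real.log a⁻¹ + y * Real.log b⁻¹) := by
  -- This is log t ≤ t - 1 at t = ra/x. With r = x + y the two error terms cancel because a + b = 1.
  have key : ∀ {x r a : ℝ}, 0 ≤ x → x ≤ r → 0 < a →
      -x * Real.log x + x * Real.log r ≤ x * Real.log a⁻¹ + (r * a - x) := by
    intro x r a hx hr ha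
    rcases hx.eq_or_lt with rfl | hx
    · simp only [neg_zero, zero_mul, add_zero, sub_zero, zero_add]; positivity
    have hr' : 0 < r := hx.trans_le hr
    have h := Real.log_le_sub_one_of_pos (show 0 < r * a / x by positivity)
    rw [Real.log_div (by positivity) (by positivity), Real.log_mul (by positivity)
      (by positivity)] at h
    have h' := mul_le_mul_of_nonneg_left h hx.le
    have : x * (r * a / x - 1) = r * a - x := by field_simp
    rw [this] at h'
    rw [Real.log_inv]
    linarith
  have h1 := key hx (show x ≤ x + y by linarith) ha
  have h2 := key hy (show y ≤ x + y by linarith) hb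
  have h3 : (x + y) * a - x + ((x + y) * b - y) = 0 := by
    linear_combination (x + y) * hab
  simp only [Real.negMulLog]
  nlinarith

lemma joinCell_snoc {n : ℕ} (C : Fin (n + 1) → Set X) (σ : Fin n → Bool) (b : Bool) :
    joinCell C (Fin.snoc σ b : Fin (n + 1) → Bool) =
      joinCell (fun i : Fin n => C i.castSucc) σ ∩
        if b then C (Fin.last n) else (C (Fin.last n))ᶜ := by
  ext x
  simp only [joinCell, Set.mem_iInter, Set.mem_inter_iff, Fin.forall_fin_succ', Fin.snoc_castSucc,
    Fin.snoc_last]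

lemma sum_snoc {n : ℕ} (f : (Fin (n + 1) → Bool) → ℝ) :
    ∑ σ, f σ = ∑ σ : Fin n → Bool, (f (Fin.snoc σ true) + f (Fin.snoc σ false)) := by
  rw [← (Fin.snocEquiv fun _ => Bool).sum_comp, Fintype.sum_prod_type]
  simp [Fin.snocEquiv, Finset.sum_add_distrib]

lemma pairwise_disjoint_joinCell {n : ℕ} (C : Fin n → Set X) :
    Pairwise (Function.onFun Disjoint (joinCell C)) := by
  intro σ τ h
  obtain ⟨i, hi⟩ := Function.ne_iff.1 h
  rw [Function.onFun, Set.disjoint_left]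
  intro x h1 h2
  simp only [joinCell, Set.mem_iInter] at h1 h2
  have h1 := h1 i
  have h2 := h2 i
  cases hs : σ i <;> cases ht : τ i <;> simp_all

variable [MeasurableSpace X]

/-- The entropy of a finite family of cells, in natural units. -/
noncomputable def cellEntropy {ι : Type*} [Fintype ι] (μ : Measure X) (R : ι → Set X) : ℝ :=
  ∑ i, Real.negMulLog (μ.real (R i))

/-- The distance in measure from `C` to the nearest union of cells. -/
noncomputable def splitSize {ι : Type*} [Fintype ι] (μ : Measure X) (R : ι → Set X)
    (C : Set X) : ℝ :=
  ∑ i, min (μ.real (R i ∩ C)) (μ.real (R i \ C))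

lemma partitionEntropy_eq {ι : Type*} [Fintype ι] (μ : Measure X) (R : ι → Set X) :
    partitionEntropy μ R = cellEntropy μ R / Real.log 2 := by
  simp only [partitionEntropy, cellEntropy, Real.negMulLog, Real.logb, Finset.sum_div,
    ← Finset.sum_neg_distrib]
  exact Finset.sum_congr rfl fun i _ => by ring

lemma measurableSet_joinCell {n : ℕ} {C : Fin n → Set X} (hC : ∀ i, MeasurableSet (C i))
    (σ : Fin n → Bool) : MeasurableSet (joinCell C σ) := by
  refine MeasurableSet.iInter fun i => ?_
  split_ifs
  · exact hC i
  · exact (hC i).compl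

lemma sum_measureReal_inter_joinCell {μ : Measure X} [IsFiniteMeasure μ] {n : ℕ}
    {C : Fin n → Set X} (hC : ∀ i, MeasurableSet (C i)) (A : Set X) :
    ∑ σ, μ.real (A ∩ joinCell C σ) = μ.real A := by
  induction n with
  | zero => simp [joinCell]
  | succ n ih =>
    rw [sum_snoc, ← ih (fun i => hC i.castSucc)]
    refine Finset.sum_congr rfl fun σ _ => ?_
    rw [joinCell_snoc, joinCell_snoc]
    simp only [if_true, Bool.false_eq_true, if_false, ← Set.inter_assoc]
    rw [← Set.sdiff_eq]
    exact measureReal_inter_add_sdiff (μ := μ)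
      (s := A ∩ joinCell (fun i : Fin n => C i.castSucc) σ) (hC _)

/-! ### Entropy growth when a partition is refined one set at a time -/

section Refinement

variable {μ : Measure X} {ι : Type*} [Fintype ι] (R : ι → Set X) {S : ℕ → Set X}

/-- The refinement of the cells `R` by the first `n` sets of the sequence `S`. -/
def refineCell (S : ℕ → Set X) (n : ℕ) (p : ι × (Fin n → Bool)) : Set X :=
  R p.1 ∩ joinCell (fun i : Fin n => S i) p.2

lemma cellEntropy_refineCell_succ (n : ℕ) :
    cellEntropy μ (refineCell R S (n + 1)) = ∑ p : ι × (Fin n → Bool),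
      (Real.negMulLog (μ.real (refineCell R S n p ∩ S n)) +
        Real.negMulLog (μ.real (refineCell R S n p \ S n))) := by
  simp only [cellEntropy, Fintype.sum_prod_type]
  refine Finset.sum_congr rfl fun i _ => ?_
  rw [sum_snoc]
  refine Finset.sum_congr rfl fun σ _ => ?_
  simp only [refineCell, joinCell_snoc, if_true, Bool.false_eq_true, if_false, Fin.val_castSucc,
    Fin.val_last, ← Set.inter_assoc, Set.sdiff_eq]

lemma cellEntropy_join_le (hR : ∀ A, ∑ i, μ.real (A ∩ R i) = μ.real A) (n : ℕ) :
    cellEntropy μ (joinCell fun i : Fin n => S i) ≤ cellEntropy μ (refineCell R S n) := by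
  rw [cellEntropy, cellEntropy, Fintype.sum_prod_type_right]
  refine Finset.sum_le_sum fun σ _ => ?_
  rw [← hR (joinCell (fun i : Fin n => S i) σ)]
  simp only [refineCell]
  simp_rw [Set.inter_comm (joinCell _ _)]
  exact Finset.le_sum_of_subadditive_on_pred Real.negMulLog (fun x => 0 ≤ x)
    (by simp) (fun x y hx hy => negMulLog_add_le hx hy) (fun x y => add_nonneg) _
    (fun i _ => measureReal_nonneg)

variable [IsProbabilityMeasure μ]

lemma cellEntropy_refineCell (hS : ∀ i, MeasurableSet (S i)) (n : ℕ) :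
    cellEntropy μ (refineCell R S n) = ∑ p : ι × (Fin n → Bool),
      Real.negMulLog (μ.real (refineCell R S n p ∩ S n) + μ.real (refineCell R S n p \ S n)) := by
  refine Finset.sum_congr rfl fun p _ => ?_
  rw [measureReal_inter_add_sdiff (hS n)]

lemma cellEntropy_add_splitSize_le (hS : ∀ i, MeasurableSet (S i)) (n : ℕ) :
    cellEntropy μ (refineCell R S n) + splitSize μ (refineCell R S n) (S n) ≤
      cellEntropy μ (refineCell R S (n + 1)) := by
  rw [cellEntropy_refineCell_succ, cellEntropy_refineCell R hS, splitSize,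
    ← Finset.sum_add_distrib]
  exact Finset.sum_le_sum fun p _ => negMulLog_add_ge measureReal_nonneg measureReal_nonneg

/-- A sum of minima is at most the minimum of the sums. -/
lemma splitSize_refineCell_le (hS : ∀ i, MeasurableSet (S i)) (n : ℕ) (C : Set X) :
    splitSize μ (refineCell R S n) C ≤ splitSize μ R C := by
  simp only [splitSize, Fintype.sum_prod_type]
  refine Finset.sum_le_sum fun i _ => le_min ?_ ?_
  · rw [← sum_measureReal_inter_joinCell (μ := μ) (C := fun i : Fin n => S i) (fun i => hS i)
      (R i ∩ C)]
    refine Finset.sum_le_sum fun σ _ => (min_le_left _ _).trans (le_of_eq ?_)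
    rw [refineCell, Set.inter_right_comm]
  · rw [← sum_measureReal_inter_joinCell (μ := μ) (C := fun i : Fin n => S i) (fun i => hS i)
      (R i \ C)]
    refine Finset.sum_le_sum fun σ _ => (min_le_right _ _).trans (le_of_eq ?_)
    rw [refineCell, Set.sdiff_eq, Set.sdiff_eq, Set.inter_right_comm]

lemma sum_measureReal_refineCell (hR : ∀ A, ∑ i, μ.real (A ∩ R i) = μ.real A)
    (hS : ∀ i, MeasurableSet (S i)) (n : ℕ) : ∑ p, μ.real (refineCell R S n p) = 1 := by
  rw [Fintype.sum_prod_type]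
  simp only [refineCell]
  have := hR Set.univ
  simp only [Set.univ_inter, probReal_univ] at this
  rw [← this]
  exact Finset.sum_congr rfl fun i _ =>
    sum_measureReal_inter_joinCell (C := fun i : Fin n => S i) (fun i => hS i) _

/-- Gibbs' inequality in each cell, with weight c on the smaller piece and 1 - c on the larger. The
total gain is at most s log(1/c) + (1 - s) log(1/(1 - c)), where s is the split size; this increases
in s because c ≤ 1/2, and equals the binary entropy at s = c. -/
lemma cellEntropy_refineCell_succ_le (hR : ∀ A, ∑ i, μ.real (A ∩ R i) = μ.real A)
    (hS : ∀ i, MeasurableSet (S i)) (n : ℕ) {c : ℝ} (hc : 0 < c) (hc' : c ≤ 1 / 2)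
    (h : splitSize μ (refineCell R S n) (S n) ≤ c) :
    cellEntropy μ (refineCell R S (n + 1)) ≤
      cellEntropy μ (refineCell R S n) + Real.binEntropy c := by
  have hl : Real.log (1 - c)⁻¹ ≤ Real.log c⁻¹ :=
    Real.log_le_log (by rw [inv_pos]; linarith) (inv_anti₀ hc (by linarith))
  have key : cellEntropy μ (refineCell R S (n + 1)) ≤ cellEntropy μ (refineCell R S n) +
      (splitSize μ (refineCell R S n) (S n) * Real.log c⁻¹ +
        ((∑ p, μ.real (refineCell R S n p)) - splitSize μ (refineCell R S n) (S n)) *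
          Real.log (1 - c)⁻¹) := by
    rw [cellEntropy_refineCell_succ, cellEntropy_refineCell R hS, splitSize,
      ← Finset.sum_sub_distrib, Finset.sum_mul, Finset.sum_mul, ← Finset.sum_add_distrib,
      ← Finset.sum_add_distrib]
    refine Finset.sum_le_sum fun p _ => ?_
    have hm : μ.real (refineCell R S n p) = μ.real (refineCell R S n p ∩ S n) +
      μ.real (refineCell R S n p \ S n) := (measureReal_inter_add_sdiff (hS n)).symm
    rw [hm]
    generalize hx : μ.real (refineCell R S n p ∩ S n) = x
    generalize hy : μ.real (refineCell R S n p \ S n) = y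
    have hx0 : 0 ≤ x := hx ▸ measureReal_nonneg
    have hy0 : 0 ≤ y := hy ▸ measureReal_nonneg
    rcases le_total x y with hxy | hxy
    · rw [min_eq_left hxy]
      have := negMulLog_add_gibbs hx0 hy0 hc (show 0 < 1 - c by linarith) (by ring)
      linarith
    · rw [min_eq_right hxy]
      have := negMulLog_add_gibbs hx0 hy0 (show 0 < 1 - c by linarith) hc (by ring)
      linarith
  rw [sum_measureReal_refineCell R hR hS] at key
  rw [Real.binEntropy]
  nlinarith

end Refinement

/-! ### Entropy of a family versus approximation by finite partitions -/

section Family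

variable {μ : Measure X} {S : ℕ → Set X}

lemma cellEntropy_refineCell_univ (n : ℕ) :
    cellEntropy μ (refineCell (fun _ : Unit => Set.univ) S n) =
      cellEntropy μ (joinCell fun i : Fin n => S i) := by
  simp [cellEntropy, refineCell, Fintype.sum_prod_type]

lemma splitSize_refineCell_univ (n : ℕ) (C : Set X) :
    splitSize μ (refineCell (fun _ : Unit => Set.univ) S n) C =
      splitSize μ (joinCell fun i : Fin n => S i) C := by
  simp [splitSize, refineCell, Fintype.sum_prod_type]

variable [IsProbabilityMeasure μ]

lemma cellEntropy_join_succ_ge (hS : ∀ i, MeasurableSet (S i)) (n : ℕ) :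
    cellEntropy μ (joinCell fun i : Fin n => S i) +
      splitSize μ (joinCell fun i : Fin n => S i) (S n) ≤
      cellEntropy μ (joinCell fun i : Fin (n + 1) => S i) := by
  have := cellEntropy_add_splitSize_le (μ := μ) (fun _ : Unit => Set.univ) hS n
  rwa [cellEntropy_refineCell_univ, splitSize_refineCell_univ, cellEntropy_refineCell_univ] at this

lemma cellEntropy_nonneg {ι : Type*} [Fintype ι] (R : ι → Set X) : 0 ≤ cellEntropy μ R :=
  Finset.sum_nonneg fun _ _ => Real.negMulLog_nonneg measureReal_nonneg measureReal_le_one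

lemma cellEntropy_join_le_mul_log_two (hS : ∀ i, MeasurableSet (S i)) (n : ℕ) :
    cellEntropy μ (joinCell fun i : Fin n => S i) ≤ n * Real.log 2 := by
  have hR : ∀ A : Set X, ∑ _i : Unit, μ.real (A ∩ Set.univ) = μ.real A := by simp
  induction n with
  | zero => simp [cellEntropy, joinCell]
  | succ n ih =>
    -- A split size never exceeds 1/2, and the binary entropy of 1/2 is log 2: one bit per set.
    have hs : splitSize μ (refineCell (fun _ : Unit => Set.univ) S n) (S n) ≤ 1 / 2 := by
      rw [← sum_measureReal_refineCell _ hR hS n, Finset.sum_div]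
      refine Finset.sum_le_sum fun p _ => ?_
      rw [← measureReal_inter_add_sdiff (μ := μ)
        (s := refineCell (fun _ : Unit => Set.univ) S n p) (hS n)]
      linarith [min_le_left (μ.real (refineCell (fun _ : Unit => Set.univ) S n p ∩ S n))
        (μ.real (refineCell (fun _ : Unit => Set.univ) S n p \ S n)),
        min_le_right (μ.real (refineCell (fun _ : Unit => Set.univ) S n p ∩ S n))
        (μ.real (refineCell (fun _ : Unit => Set.univ) S n p \ S n))]
    have h := cellEntropy_refineCell_succ_le _ hR hS n one_half_pos le_rfl hs
    rw [cellEntropy_refineCell_univ, cellEntropy_refineCell_univ, one_div,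
      Real.binEntropy_two_inv] at h
    push_cast
    linarith

lemma sequenceEntropy_bounds (hS : ∀ i, MeasurableSet (S i)) (n : ℕ) :
    0 ≤ partitionEntropy μ (joinCell fun i : Fin n => S i) / n ∧
      partitionEntropy μ (joinCell fun i : Fin n => S i) / n ≤ 1 := by
  have h2 : 0 < Real.log 2 := Real.log_pos one_lt_two
  rw [partitionEntropy_eq]
  refine ⟨div_nonneg (div_nonneg (cellEntropy_nonneg _) h2.le) n.cast_nonneg, ?_⟩
  refine div_le_one_of_le₀ ?_ n.cast_nonneg
  rw [div_le_iff₀ h2]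
  exact cellEntropy_join_le_mul_log_two hS n

lemma isBoundedUnder_ge_sequenceEntropy (hS : ∀ i, MeasurableSet (S i)) :
    IsBoundedUnder (· ≥ ·) atTop
      fun n : ℕ => partitionEntropy μ (joinCell fun i : Fin n => S i) / n :=
  isBoundedUnder_of ⟨0, fun n => (sequenceEntropy_bounds hS n).1⟩

lemma isBoundedUnder_le_sequenceEntropy (hS : ∀ i, MeasurableSet (S i)) :
    IsBoundedUnder (· ≤ ·) atTop
      fun n : ℕ => partitionEntropy μ (joinCell fun i : Fin n => S i) / n :=
  isBoundedUnder_of ⟨1, fun n => (sequenceEntropy_bounds hS n).2⟩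

lemma sequenceEntropy_le_one (hS : ∀ i, MeasurableSet (S i)) : sequenceEntropy μ S ≤ 1 :=
  liminf_le_of_frequently_le (Frequently.of_forall fun n => (sequenceEntropy_bounds hS n).2)
    (isBoundedUnder_ge_sequenceEntropy hS)

/-- Dependent choice in which each term depends on the whole initial segment. The segments `f n` are
built first, and `hf` identifies them as restrictions of one sequence. -/
lemma exists_seq_of_forall_fin {α : Type*} {P : ∀ n : ℕ, (Fin n → α) → α → Prop}
    (h : ∀ n (B : Fin n → α), ∃ a, P n B a) :
    ∃ S : ℕ → α, ∀ n, P n (fun i : Fin n => S i) (S n) := by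
  choose g hg using h
  let f : ∀ n : ℕ, Fin n → α :=
    Nat.rec (fun i => i.elim0) fun n B => (Fin.snoc B (g n B) : Fin (n + 1) → α)
  have hf : ∀ n, (fun i : Fin n => g i (f i)) = f n := by
    intro n
    induction n with
    | zero => exact funext fun i => i.elim0
    | succ n ih =>
      funext i
      change _ = (Fin.snoc (f n) (g n (f n)) : Fin (n + 1) → α) i
      refine Fin.lastCases ?_ (fun i => ?_) i
      · simp
      · rw [Fin.snoc_castSucc, ← ih]
        rfl
  refine ⟨fun n => g n (f n), fun n => ?_⟩
  rw [hf n]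
  exact hg n _

/-- A family in which every finite subfamily leaves a definite amount of some member undecided
has positive entropy. -/
lemma familyEntropy_pos {𝒞 : Set (Set X)} (h𝒞 : ∀ C ∈ 𝒞, MeasurableSet C) {c : ℝ} (hc : 0 < c)
    (h : ∀ n (B : Fin n → 𝒞), ∃ C : 𝒞, c ≤ splitSize μ (joinCell fun i => (B i : Set X)) C) :
    0 < familyEntropy μ 𝒞 := by
  obtain ⟨S, hS⟩ := exists_seq_of_forall_fin h
  have hm : ∀ S : ℕ → 𝒞, ∀ i, MeasurableSet (S i : Set X) := fun S i => h𝒞 _ (S i).2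
  have hl : ∀ n : ℕ, n * c ≤ cellEntropy μ (joinCell fun i : Fin n => (S i : Set X)) := by
    intro n
    induction n with
    | zero => simpa using cellEntropy_nonneg _
    | succ n ih =>
      have := cellEntropy_join_succ_ge (μ := μ) (S := fun i => (S i : Set X)) (hm S) n
      have := hS n
      push_cast
      linarith
  have h2 : 0 < Real.log 2 := Real.log_pos one_lt_two
  have hs : c / Real.log 2 ≤ sequenceEntropy μ fun i => (S i : Set X) := by
    refine le_liminf_of_le (isBoundedUnder_le_sequenceEntropy (hm S)).isCoboundedUnder_ge ?_
    filter_upwards [eventually_gt_atTop 0] with n hn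
    have hn' : (0 : ℝ) < n := by exact_mod_cast hn
    rw [partitionEntropy_eq, div_div, div_le_div_iff₀ h2 (by positivity)]
    nlinarith [hl n]
  refine (div_pos hc h2).trans_le (hs.trans ?_)
  exact le_ciSup (f := fun S : ℕ → 𝒞 => sequenceEntropy μ fun i => (S i : Set X))
    ⟨1, by rintro _ ⟨S, rfl⟩; exact sequenceEntropy_le_one (hm S)⟩ S

lemma liminf_div_nat_le {u : ℕ → ℝ} {L K ε : ℝ} (hL : 0 < L) (hε : 0 < ε) (hu : ∀ n, 0 ≤ u n)
    (h : ∀ n : ℕ, u n ≤ K + n * (ε / 2 * L)) :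
    liminf (fun n : ℕ => u n / L / n) atTop ≤ ε := by
  refine liminf_le_of_frequently_le (Eventually.frequently ?_)
    (isBoundedUnder_of ⟨0, fun n => div_nonneg (div_nonneg (hu n) hL.le) n.cast_nonneg⟩)
  have ht : Tendsto (fun n : ℕ => K / L / n) atTop (𝓝 0) :=
    tendsto_const_div_atTop_nhds_zero_nat _
  filter_upwards [ht.eventually_lt_const (half_pos hε), eventually_gt_atTop 0] with n hn hn0
  have hn' : (0 : ℝ) < n := by exact_mod_cast hn0
  rw [div_div, div_le_iff₀ (by positivity)]
  rw [div_div, div_lt_iff₀ (by positivity)] at hn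
  linarith [h n]

lemma familyEntropy_nonpos {𝒞 : Set (Set X)}
    (h : ∀ η > 0, ∃ K, ∀ S : ℕ → Set X, (∀ i, S i ∈ 𝒞) → ∀ n : ℕ,
      cellEntropy μ (joinCell fun i : Fin n => S i) ≤ K + n * η) :
    familyEntropy μ 𝒞 ≤ 0 := by
  refine Real.iSup_le (fun S => ?_) le_rfl
  refine le_of_forall_pos_le_add fun ε hε => ?_
  have h2 : 0 < Real.log 2 := Real.log_pos one_lt_two
  obtain ⟨K, hK⟩ := h (ε / 2 * Real.log 2) (by positivity)
  have := liminf_div_nat_le (K := K) h2 hε (fun n => cellEntropy_nonneg _)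
    (hK (fun i => (S i : Set X)) (fun i => (S i).2))
  simp only [← partitionEntropy_eq] at this
  rwa [zero_add, sequenceEntropy]

/-- A family of positive entropy is not approximated by unions of cells of finite partitions. -/
lemma exists_splitSize_of_familyEntropy_pos {𝒞 : Set (Set X)}
    (h𝒞 : ∀ C ∈ 𝒞, MeasurableSet C) (h : 0 < familyEntropy μ 𝒞) :
    ∃ c > 0, ∀ m (B : Fin m → Set X), (∀ i, MeasurableSet (B i)) →
      ∃ C ∈ 𝒞, c ≤ splitSize μ (joinCell B) C := by
  by_contra! H
  refine h.not_ge (familyEntropy_nonpos fun η hη => ?_)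
  -- If some partition B is cut by less than c by every member, each new set costs at most h(c) < η
  -- once B is known.
  obtain ⟨c, hcη, hc, hc2⟩ : ∃ c : ℝ, Real.binEntropy c < η ∧ c ∈ Set.Ioo (0 : ℝ) (1 / 2) := by
    have h1 : Tendsto Real.binEntropy (𝓝[>] 0) (𝓝 0) := by
      have := Real.binEntropy_continuous.tendsto 0
      rw [Real.binEntropy_zero] at this
      exact this.mono_left nhdsWithin_le_nhds
    exact ((h1.eventually_lt_const hη).and
      (Ioo_mem_nhdsGT (show (0 : ℝ) < 1 / 2 by norm_num))).exists
  obtain ⟨m, B, hB, hBC⟩ := H c hc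
  -- The constant is the entropy of B itself: at stage 0 no set of the sequence is used, so ∅ is a
  -- dummy.
  refine ⟨cellEntropy μ (refineCell (joinCell B) (fun _ => ∅) 0), fun S hS n => ?_⟩
  have hSm : ∀ i, MeasurableSet (S i) := fun i => h𝒞 _ (hS i)
  have hR : ∀ A, ∑ σ, μ.real (A ∩ joinCell B σ) = μ.real A := sum_measureReal_inter_joinCell hB
  refine (cellEntropy_join_le _ hR n).trans ?_
  induction n with
  | zero => simp [cellEntropy, refineCell, joinCell]
  | succ n ih =>
    refine (cellEntropy_refineCell_succ_le _ hR hSm n hc hc2.le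
      ((splitSize_refineCell_le _ hSm n _).trans (hBC _ (hS n)).le)).trans ?_
    push_cast
    linarith

/-- If every non-null measurable set had measure at least ε, every join would have entropy at most
log(1/ε), hence rate zero. This replaces any assumption that the space has no atoms. -/
lemma exists_small_of_familyEntropy_pos {𝒞 : Set (Set X)}
    (h𝒞 : ∀ C ∈ 𝒞, MeasurableSet C) (h : 0 < familyEntropy μ 𝒞) {ε : ℝ} (hε : 0 < ε) :
    ∃ A, MeasurableSet A ∧ 0 < μ.real A ∧ μ.real A < ε := by
  by_contra! H
  refine h.not_ge (familyEntropy_nonpos fun η hη => ⟨Real.log ε⁻¹, fun S hS n => ?_⟩)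
  have hSm : ∀ i, MeasurableSet (S i) := fun i => h𝒞 _ (hS i)
  have : cellEntropy μ (joinCell fun i : Fin n => S i) ≤
      ∑ σ, μ.real (Set.univ ∩ joinCell (fun i : Fin n => S i) σ) * Real.log ε⁻¹ := by
    refine Finset.sum_le_sum fun σ _ => ?_
    rw [Set.univ_inter]
    rcases (measureReal_nonneg (μ := μ) (s := joinCell (fun i : Fin n => S i) σ)).eq_or_lt
      with h0 | h0
    · simp [← h0]
    have := H _ (measurableSet_joinCell (fun i : Fin n => hSm i) σ) h0
    rw [Real.negMulLog, Real.log_inv]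
    have := Real.log_le_log hε this
    nlinarith
  rw [← Finset.sum_mul, sum_measureReal_inter_joinCell fun i : Fin n => hSm i, probReal_univ,
    one_mul] at this
  have : 0 ≤ n * η := by positivity
  linarith

end Family

end UniformMixing

/-! ### Mixing averages, and uniform mixing on families of entropy zero -/

namespace UniformMixing

variable {X : Type*} [MeasurableSpace X] {μ : Measure X}

lemma mixingAverage_nonneg (T : X → X) (A B : Set X) (n : ℕ) : 0 ≤ mixingAverage μ T A B n :=
  div_nonneg (Finset.sum_nonneg fun _ _ => abs_nonneg _) n.cast_nonneg

/-- Simultaneous near independence of finitely many pairs of sets at a single time. -/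
lemma IsWeakMixing.exists_correlation_lt {T : X → X} (hT : IsWeakMixing μ T) {ι : Type*}
    [Fintype ι] {W K : ι → Set X} (hW : ∀ p, MeasurableSet (W p)) (hK : ∀ p, MeasurableSet (K p))
    {ε : ℝ} (hε : 0 < ε) :
    ∃ i : ℕ, ∀ p, |μ.real (W p ∩ T^[i] ⁻¹' K p) - μ.real (W p) * μ.real (K p)| < ε := by
  -- Average the sum over all pairs: a Cesàro mean below ε has a term below ε, and that time serves
  -- every pair.
  have ht : Tendsto (fun n => ∑ p, mixingAverage μ T (W p) (K p) n) atTop (𝓝 0) := by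
    have := tendsto_finsetSum Finset.univ
      fun p _ => hT.tendsto_mixingAverage (W p) (K p) (hW p) (hK p)
    simpa using this
  obtain ⟨n, hn, hn0⟩ := ((ht.eventually_lt_const hε).and (eventually_gt_atTop 0)).exists
  have hn' : (0 : ℝ) < n := by exact_mod_cast hn0
  simp only [mixingAverage] at hn
  rw [← Finset.sum_div, div_lt_iff₀ hn', Finset.sum_comm] at hn
  have hc : ε * n = ∑ _i ∈ Finset.range n, ε := by simp [mul_comm]
  rw [hc] at hn
  obtain ⟨i, -, hi⟩ := Finset.exists_lt_of_sum_lt hn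
  exact ⟨i, fun p => (Finset.single_le_sum (f := fun p =>
    |μ.real (W p ∩ T^[i] ⁻¹' K p) - μ.real (W p) * μ.real (K p)|)
    (fun _ _ => abs_nonneg _) (Finset.mem_univ p)).trans_lt hi⟩

variable [IsProbabilityMeasure μ]

lemma measureReal_symmDiff_inter_le (A B A' B' : Set X) :
    μ.real ((A ∩ B) ∆ (A' ∩ B')) ≤ μ.real (A ∆ A') + μ.real (B ∆ B') := by
  refine (measureReal_mono ?_).trans (measureReal_union_le _ _)
  intro x
  simp only [Set.mem_symmDiff, Set.mem_inter_iff, Set.mem_union]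
  tauto

lemma abs_correlation_sub_le {A B A' B' : Set X} (hA : MeasurableSet A) (hB : MeasurableSet B)
    (hA' : MeasurableSet A') (hB' : MeasurableSet B') {T : X → X} (hT : MeasurePreserving T μ μ) :
    |(μ.real (A ∩ T ⁻¹' B) - μ.real A * μ.real B) -
      (μ.real (A' ∩ T ⁻¹' B') - μ.real A' * μ.real B')| ≤
      2 * (μ.real (A ∆ A') + μ.real (B ∆ B')) := by
  have h1 := abs_measureReal_sub_le_measureReal_symmDiff (μ := μ)
    (hA.inter (hT.measurable hB)).nullMeasurableSet
    (hA'.inter (hT.measurable hB')).nullMeasurableSet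
  have h2 := measureReal_symmDiff_inter_le (μ := μ) A (T ⁻¹' B) A' (T ⁻¹' B')
  rw [← Set.preimage_symmDiff, hT.measureReal_preimage (hB.symmDiff hB').nullMeasurableSet] at h2
  have h3 := abs_measureReal_sub_le_measureReal_symmDiff (μ := μ)
    hA.nullMeasurableSet hA'.nullMeasurableSet
  have h4 := abs_measureReal_sub_le_measureReal_symmDiff (μ := μ)
    hB.nullMeasurableSet hB'.nullMeasurableSet
  have ha : μ.real A' ≤ 1 := measureReal_le_one
  have hb : μ.real B ≤ 1 := measureReal_le_one
  have ha0 : 0 ≤ μ.real A' := measureReal_nonneg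
  have hb0 : 0 ≤ μ.real B := measureReal_nonneg
  have h5 : |μ.real A * μ.real B - μ.real A' * μ.real B'| ≤
      μ.real (A ∆ A') + μ.real (B ∆ B') := by
    have : μ.real A * μ.real B - μ.real A' * μ.real B' =
        (μ.real A - μ.real A') * μ.real B + μ.real A' * (μ.real B - μ.real B') := by ring
    rw [this]
    refine (abs_add_le _ _).trans ?_
    rw [abs_mul, abs_mul, abs_of_nonneg ha0, abs_of_nonneg hb0]
    nlinarith [abs_nonneg (μ.real A - μ.real A'), abs_nonneg (μ.real B - μ.real B')]
  rw [abs_le] at *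
  constructor <;> linarith

lemma mixingAverage_le_one (T : X → X) (A B : Set X) (n : ℕ) : mixingAverage μ T A B n ≤ 1 := by
  refine div_le_one_of_le₀ ?_ n.cast_nonneg
  have : ∀ i ∈ Finset.range n, |μ.real (A ∩ T^[i] ⁻¹' B) - μ.real A * μ.real B| ≤ 1 := by
    intro i _
    have h1 : μ.real (A ∩ T^[i] ⁻¹' B) ≤ 1 := measureReal_le_one
    have h2 : 0 ≤ μ.real (A ∩ T^[i] ⁻¹' B) := measureReal_nonneg
    have h3 : μ.real A * μ.real B ≤ 1 :=
      mul_le_one₀ measureReal_le_one measureReal_nonneg measureReal_le_one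
    have h4 : 0 ≤ μ.real A * μ.real B := mul_nonneg measureReal_nonneg measureReal_nonneg
    rw [abs_le]
    constructor <;> linarith
  simpa using Finset.sum_le_card_nsmul _ _ _ this

/-- The error does not depend on n. This carries part (i) and also gives continuity in the weak
topology. -/
lemma mixingAverage_le_add {A B A' B' : Set X} (hA : MeasurableSet A) (hB : MeasurableSet B)
    (hA' : MeasurableSet A') (hB' : MeasurableSet B') {T : X → X} (hT : MeasurePreserving T μ μ)
    (n : ℕ) : mixingAverage μ T A B n ≤
      mixingAverage μ T A' B' n + 2 * (μ.real (A ∆ A') + μ.real (B ∆ B')) := by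
  rcases Nat.eq_zero_or_pos n with rfl | hn
  · simp only [mixingAverage, Nat.cast_zero, div_zero, zero_add]
    have : 0 ≤ μ.real (A ∆ A') := measureReal_nonneg
    have : 0 ≤ μ.real (B ∆ B') := measureReal_nonneg
    positivity
  have hn' : (0 : ℝ) < n := by exact_mod_cast hn
  rw [mixingAverage, mixingAverage, div_add' _ _ _ hn'.ne', div_le_div_iff_of_pos_right hn']
  have : 2 * (μ.real (A ∆ A') + μ.real (B ∆ B')) * n =
      ∑ _i ∈ Finset.range n, 2 * (μ.real (A ∆ A') + μ.real (B ∆ B')) := by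
    simp [mul_comm]
  rw [this, ← Finset.sum_add_distrib]
  refine Finset.sum_le_sum fun i _ => ?_
  have h := abs_correlation_sub_le hA hB hA' hB' (hT.iterate i)
  have := abs_sub_abs_le_abs_sub (μ.real (A ∩ T^[i] ⁻¹' B) - μ.real A * μ.real B)
    (μ.real (A' ∩ T^[i] ⁻¹' B') - μ.real A' * μ.real B')
  linarith

/-- The union of the cells of `R` with index in `s`. -/
def cellUnion {ι : Type*} (R : ι → Set X) (s : Finset ι) : Set X := ⋃ i ∈ s, R i

/-- A set is approximated by a union of cells up to its split size. -/
lemma exists_cellUnion_symmDiff_le {n : ℕ} {B : Fin n → Set X} (hB : ∀ i, MeasurableSet (B i))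
    (C : Set X) : ∃ s, μ.real (C ∆ cellUnion (joinCell B) s) ≤ splitSize μ (joinCell B) C := by
  classical
  -- Take the cells of which C fills at least half; in each cell the error is then the smaller
  -- piece.
  refine ⟨Finset.univ.filter fun σ =>
    μ.real (joinCell B σ \ C) ≤ μ.real (joinCell B σ ∩ C), ?_⟩
  rw [← sum_measureReal_inter_joinCell hB (C ∆ _)]
  refine Finset.sum_le_sum fun σ _ => ?_
  have hd : ∀ {x τ}, x ∈ joinCell B σ → x ∈ joinCell B τ → τ = σ := by
    intro x τ h1 h2
    by_contra h
    exact Set.disjoint_left.1 (pairwise_disjoint_joinCell B h) h2 h1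
  have hU : ∀ {x}, x ∈ joinCell B σ → (x ∈ cellUnion (joinCell B) (Finset.univ.filter fun σ =>
      μ.real (joinCell B σ \ C) ≤ μ.real (joinCell B σ ∩ C)) ↔
      μ.real (joinCell B σ \ C) ≤ μ.real (joinCell B σ ∩ C)) := by
    intro x hx
    simp only [cellUnion, Set.mem_iUnion, Finset.mem_filter, Finset.mem_univ, true_and,
      exists_prop]
    constructor
    · rintro ⟨τ, h1, h2⟩
      rwa [hd hx h2] at h1
    · exact fun h => ⟨σ, h, hx⟩
  by_cases h : μ.real (joinCell B σ \ C) ≤ μ.real (joinCell B σ ∩ C)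
  · rw [min_eq_right h]
    refine measureReal_mono ?_
    rintro x ⟨hx1, hx2⟩
    have := hU hx2
    simp only [Set.mem_symmDiff] at hx1
    exact ⟨hx2, by tauto⟩
  · rw [min_eq_left (not_le.1 h).le]
    refine measureReal_mono ?_
    rintro x ⟨hx1, hx2⟩
    have := hU hx2
    simp only [Set.mem_symmDiff] at hx1
    exact ⟨hx2, by tauto⟩

/-- A weak mixing transformation is uniformly weak mixing on a family of entropy zero. -/
theorem IsWeakMixing.tendsto_iSup_mixingAverage {T : X → X} (hT : IsWeakMixing μ T)
    {𝒞 : Set (Set X)} (h𝒞 : ∀ C ∈ 𝒞, MeasurableSet C) (h : familyEntropy μ 𝒞 = 0) :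
    Tendsto (fun n : ℕ => ⨆ p : 𝒞 × 𝒞, mixingAverage μ T p.1 p.2 n) atTop (𝓝 0) := by
  have hnonneg : ∀ n : ℕ, 0 ≤ ⨆ p : 𝒞 × 𝒞, mixingAverage μ T p.1 p.2 n := fun n =>
    Real.iSup_nonneg fun p => mixingAverage_nonneg _ _ _ _
  refine tendsto_order.2 ⟨fun a ha => Eventually.of_forall fun n => ha.trans_le (hnonneg n),
    fun ε hε => ?_⟩
  -- Approximating both sets within ε/8 costs 2(ε/8 + ε/8) = ε/2; the finitely many pairs of unions
  -- of cells contribute ε/4 for large n, giving 3ε/4 in total.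
  obtain ⟨m, B, hB⟩ : ∃ m, ∃ B : Fin m → 𝒞, ∀ C : 𝒞,
      splitSize μ (joinCell fun i => (B i : Set X)) C < ε / 8 := by
    by_contra! H
    exact (familyEntropy_pos h𝒞 (by positivity) H).ne' h
  have hBm : ∀ i, MeasurableSet (B i : Set X) := fun i => h𝒞 _ (B i).2
  set U := cellUnion (joinCell fun i => (B i : Set X)) with hU
  have hUm : ∀ s, MeasurableSet (U s) := fun s =>
    Finset.measurableSet_biUnion s fun σ _ => measurableSet_joinCell hBm σ
  have hev : ∀ᶠ n in atTop, ∀ s t, mixingAverage μ T (U s) (U t) n < ε / 4 := by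
    rw [eventually_all]
    intro s
    rw [eventually_all]
    intro t
    exact (hT.tendsto_mixingAverage _ _ (hUm s) (hUm t)).eventually_lt_const (by positivity)
  filter_upwards [hev] with n hn
  refine (Real.iSup_le (fun p => ?_) (show 0 ≤ 3 * ε / 4 by positivity)).trans_lt (by linarith)
  obtain ⟨s, hs⟩ := exists_cellUnion_symmDiff_le (μ := μ) hBm (p.1 : Set X)
  obtain ⟨t, ht⟩ := exists_cellUnion_symmDiff_le (μ := μ) hBm (p.2 : Set X)
  have := mixingAverage_le_add (h𝒞 _ p.1.2) (h𝒞 _ p.2.2) (hUm s) (hUm t) hT.measurePreserving n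
  linarith [hn s t, hB p.1, hB p.2]

end UniformMixing

/-! ### Almost invariant sets -/

namespace UniformMixing

variable {X : Type*} [MeasurableSpace X] {μ : Measure X}

section AlmostInvariant

variable [IsProbabilityMeasure μ]

lemma measurableSet_avoid {T : X → X} (hT : Measurable T) {A : Set X} (hA : MeasurableSet A)
    (J : ℕ) : MeasurableSet {x | ∀ j < J, T^[j] x ∉ A} := by
  simp only [Set.ofPred_forall]
  exact MeasurableSet.iInter fun j => MeasurableSet.iInter fun _ => (hT.iterate j hA).compl

/-- Almost every orbit of a weak mixing transformation enters a set of positive measure. -/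
lemma IsWeakMixing.tendsto_measureReal_avoid {T : X → X} (hT : IsWeakMixing μ T) {A : Set X}
    (hA : MeasurableSet A) (hA0 : 0 < μ.real A) :
    Tendsto (fun J : ℕ => μ.real {x | ∀ j < J, T^[j] x ∉ A}) atTop (𝓝 0) := by
  have hE := measurableSet_avoid hT.measurePreserving.measurable hA
  -- The set Z of points that never enter A misses every T⁻ⁱA, so all its correlations with A equal
  -- -μ(Z)μ(A); weak mixing forces μ(Z) = 0.
  have hZ : μ (⋂ J : ℕ, {x | ∀ j < J, T^[j] x ∉ A}) = 0 := by
    set Z := ⋂ J : ℕ, {x | ∀ j < J, T^[j] x ∉ A} with hZdef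
    by_contra hne
    have hZ0 : 0 < μ.real Z :=
      ENNReal.toReal_pos hne (measure_ne_top _ _)
    obtain ⟨i, hi⟩ := hT.exists_correlation_lt (ι := Unit) (W := fun _ => Z) (K := fun _ => A)
      (fun _ => MeasurableSet.iInter hE) (fun _ => hA) (mul_pos hZ0 hA0)
    have : Z ∩ T^[i] ⁻¹' A = ∅ := by
      ext x
      simp only [hZdef, Set.mem_inter_iff, Set.mem_iInter, Set.mem_ofPred_eq, Set.mem_preimage,
        Set.mem_empty_iff_false, iff_false, not_and]
      exact fun h => h (i + 1) i (Nat.lt_succ_self i)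
    have hi := hi ()
    rw [this, measureReal_empty, zero_sub, abs_neg, abs_of_pos (mul_pos hZ0 hA0)] at hi
    exact lt_irrefl _ hi
  have := tendsto_measure_iInter_atTop (μ := μ) (fun J => (hE J).nullMeasurableSet)
    (fun J J' h x hx j hj => hx j (hj.trans_le h)) ⟨0, measure_ne_top _ _⟩
  rw [hZ] at this
  exact (ENNReal.tendsto_toReal ENNReal.zero_ne_top).comp this

lemma sum_measureReal_inter {ι : Type*} [Fintype ι] {V : ι → Set X}
    (hV : ∀ i, MeasurableSet (V i)) (hd : Pairwise (Function.onFun Disjoint V)) {S : Set X}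
    (hS : MeasurableSet S) : ∑ i, μ.real (S ∩ V i) = μ.real (S ∩ ⋃ i, V i) := by
  rw [Set.inter_iUnion, measureReal_iUnion_fintype
    (fun i j hij => (hd hij).mono Set.inter_subset_right Set.inter_subset_right)
    fun i => hS.inter (hV i)]

/-- Almost invariant sets that are nearly independent of a given finite family. -/
lemma IsWeakMixing.exists_almostInvariant {T : X → X} (hT : IsWeakMixing μ T)
    (hsmall : ∀ ε > 0, ∃ A, MeasurableSet A ∧ 0 < μ.real A ∧ μ.real A < ε) {K : Set X}
    (hK : MeasurableSet K) {ι : Type*} [Fintype ι] {B : ι → Set X}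
    (hB : ∀ i, MeasurableSet (B i)) {δ : ℝ} (hδ : 0 < δ) :
    ∃ F, MeasurableSet F ∧ μ.real (F ∆ (T ⁻¹' F)) ≤ δ ∧
      ∀ i, |μ.real (B i ∩ F) - μ.real (B i) * μ.real K| ≤ δ := by
  obtain ⟨A, hA, hA0, hAδ⟩ := hsmall (δ / 2) (half_pos hδ)
  have hTm := hT.measurePreserving.measurable
  obtain ⟨J, hJ⟩ := ((hT.tendsto_measureReal_avoid hA hA0).eventually_lt_const
    (half_pos hδ)).exists
  -- `V j` is the set of points whose first entrance to A is at time j. Outside A, one application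
  -- of T lowers this time by one.
  let V : ℕ → Set X := fun j => T^[j] ⁻¹' A ∩ {x | ∀ l < j, T^[l] x ∉ A}
  have hV : ∀ j, MeasurableSet (V j) := by
    intro j
    exact (hTm.iterate j hA).inter (measurableSet_avoid hTm hA j)
  have hVd : Pairwise (Function.onFun Disjoint fun j : Fin J => V j) := by
    intro i j hij
    rw [Function.onFun, Set.disjoint_left]
    rintro x ⟨h1, h2⟩ ⟨h3, h4⟩
    rcases lt_or_gt_of_ne (Fin.val_ne_of_ne hij) with h | h
    · exact h4 _ h h1
    · exact h2 _ h h3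
  have hVU : (⋃ j : Fin J, V j)ᶜ ⊆ {x | ∀ j < J, T^[j] x ∉ A} := by
    intro x hx j
    induction j using Nat.strong_induction_on with
    | _ j ih =>
      intro hj hxj
      exact hx (Set.mem_iUnion.2 ⟨⟨j, hj⟩, hxj, fun l hl => ih l hl (hl.trans hj)⟩)
  -- One time i serves all cells and levels; the J errors of a cell add up to at most δ/2.
  obtain ⟨i, hi⟩ := hT.exists_correlation_lt (ι := ι × Fin J)
    (W := fun p => B p.1 ∩ V p.2) (K := fun p => T^[p.2] ⁻¹' K)
    (fun p => (hB _).inter (hV _)) (fun p => hTm.iterate _ hK)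
    (show 0 < δ / (2 * (J + 1)) by positivity)
  -- With y = T^j x the entrance point of x, the condition reads T^i y ∈ K. It depends on y alone,
  -- so it is constant along an orbit until the orbit reaches A.
  let W : Fin J → Set X := fun j => V j ∩ T^[i] ⁻¹' (T^[j] ⁻¹' K)
  have hW : ∀ j, MeasurableSet (W j) := fun j =>
    (hV j).inter (hTm.iterate i (hTm.iterate j hK))
  have hWd : Pairwise (Function.onFun Disjoint W) := fun a b hab =>
    (hVd hab).mono Set.inter_subset_left Set.inter_subset_left
  refine ⟨⋃ j, W j, MeasurableSet.iUnion hW, ?_, fun b => ?_⟩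
  -- Membership can change only when x has entrance time 0, or when its entrance time is J and falls
  -- below the cutoff at T x. Both exceptional sets have measure μ(A) < δ/2.
  · have hsub : (⋃ j, W j) ∆ (T ⁻¹' ⋃ j, W j) ⊆ A ∪ T^[J] ⁻¹' A := by
      intro x hx
      by_contra hxA
      simp only [Set.mem_union, Set.mem_preimage, not_or] at hxA
      have hVx : ∀ j, T x ∈ V j ↔ x ∈ V (j + 1) := by
        intro j
        simp only [V, Set.mem_inter_iff, Set.mem_preimage, Set.mem_ofPred_eq,
          ← Function.iterate_succ_apply]
        refine and_congr_right fun _ => ⟨fun h l hl => ?_, fun h l hl => h _ (by omega)⟩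
        rcases l with - | l
        · exact hxA.1
        · exact h l (by omega)
      have hKx : ∀ j, T^[j] (T^[i] (T x)) = T^[j + 1] (T^[i] x) := by
        intro j
        rw [Function.iterate_succ_apply, ← Function.iterate_succ_apply' T i,
          Function.iterate_succ_apply]
      have : x ∈ (⋃ j, W j) ↔ T x ∈ ⋃ j, W j := by
        simp only [Set.mem_iUnion, W, Set.mem_inter_iff, Set.mem_preimage, hVx, hKx]
        constructor
        · rintro ⟨⟨j, hj⟩, h1, h2⟩
          rcases j with - | j
          · exact absurd h1.1 hxA.1
          · exact ⟨⟨j, by omega⟩, h1, h2⟩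
        · rintro ⟨⟨j, hj⟩, h1, h2⟩
          rcases Nat.lt_or_ge (j + 1) J with h | h
          · exact ⟨⟨j + 1, h⟩, h1, h2⟩
          · obtain rfl : J = j + 1 := by omega
            exact absurd h1.1 hxA.2
      rw [Set.mem_symmDiff, Set.mem_preimage] at hx
      tauto
    refine (measureReal_mono hsub).trans ((measureReal_union_le _ _).trans ?_)
    rw [(hT.measurePreserving.iterate J).measureReal_preimage hA.nullMeasurableSet]
    linarith
  · have h1 := sum_measureReal_inter (μ := μ) hW hWd (hB b)
    have h2 := sum_measureReal_inter (μ := μ) (fun j : Fin J => hV j) hVd (hB b)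
    have h3 : μ.real (B b ∩ ⋃ j : Fin J, V j) ≤ μ.real (B b) :=
      measureReal_mono Set.inter_subset_left
    have h4 : μ.real (B b) ≤ μ.real (B b ∩ ⋃ j : Fin J, V j) + δ / 2 := by
      have : B b ⊆ (B b ∩ ⋃ j : Fin J, V j) ∪ {x | ∀ j < J, T^[j] x ∉ A} := by
        intro x hx
        by_cases h : x ∈ ⋃ j : Fin J, V j
        · exact Or.inl ⟨hx, h⟩
        · exact Or.inr (hVU h)
      have := (measureReal_mono this).trans (measureReal_union_le (μ := μ) _ _)
      linarith
    have h5 : |∑ j, μ.real (B b ∩ W j) - (∑ j : Fin J, μ.real (B b ∩ V j)) * μ.real K| ≤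
        δ / 2 := by
      rw [Finset.sum_mul, ← Finset.sum_sub_distrib]
      refine (Finset.abs_sum_le_sum_abs _ _).trans ?_
      have : ∀ j ∈ Finset.univ, |μ.real (B b ∩ W j) - μ.real (B b ∩ V j) * μ.real K| ≤
          δ / (2 * (J + 1)) := by
        intro j _
        have := hi (b, j)
        simp only [(hT.measurePreserving.iterate j).measureReal_preimage
          hK.nullMeasurableSet] at this
        rw [← Set.inter_assoc]
        exact this.le
      refine (Finset.sum_le_card_nsmul _ _ _ this).trans ?_
      rw [Finset.card_univ, Fintype.card_fin, nsmul_eq_mul, mul_div_assoc',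
        div_le_div_iff₀ (by positivity) (by positivity)]
      nlinarith
    rw [h1, h2] at h5
    have hk0 : 0 ≤ μ.real K := measureReal_nonneg
    have hk1 : μ.real K ≤ 1 := measureReal_le_one
    rw [abs_le] at h5 ⊢
    constructor <;> nlinarith

end AlmostInvariant

/-! ### Rearranging a set inside the cells of a partition -/

section Rearrangement

/-- The involution exchanging `M` and its image under `e`. -/
noncomputable def swapEquiv (e : X ≃ᵐ X) {M : Set X} (hM : MeasurableSet M)
    (hd : ∀ x ∈ M, e x ∉ M) : X ≃ᵐ X :=
  open Classical in
  let s : X → X := fun x => if x ∈ M then e x else if e.symm x ∈ M then e.symm x else x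
  have hs : Function.Involutive s := by
    intro x
    by_cases h1 : x ∈ M
    · simp [s, h1, hd x h1]
    · by_cases h2 : e.symm x ∈ M
      · simp [s, h1, h2]
      · simp [s, h1, h2]
  have hm : Measurable s :=
    Measurable.ite hM e.measurable (Measurable.ite (e.symm.measurable hM) e.symm.measurable
      measurable_id)
  { toEquiv := hs.toPerm s
    measurable_toFun := hm
    measurable_invFun := hm }

section swapEquiv

variable (e : X ≃ᵐ X) {M : Set X} (hM : MeasurableSet M) (hd : ∀ x ∈ M, e x ∉ M)

lemma swapEquiv_symm : (swapEquiv e hM hd).symm = swapEquiv e hM hd := rfl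

lemma swapEquiv_of_mem {x : X} (hx : x ∈ M) : swapEquiv e hM hd x = e x := by
  classical exact if_pos hx

lemma swapEquiv_of_symm_mem {x : X} (hx : e.symm x ∈ M) : swapEquiv e hM hd x = e.symm x := by
  classical
  have : x ∉ M := fun h => by simpa using hd _ hx (by simpa using h)
  exact (if_neg this).trans (if_pos hx)

lemma swapEquiv_of_notMem {x : X} (hx : x ∉ M) (hx' : e.symm x ∉ M) :
    swapEquiv e hM hd x = x := by
  classical exact (if_neg hx).trans (if_neg hx')

/-- Cut the space into M, its image `e.symm ⁻¹' M`, and the rest. The swap exchanges the first two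
by e and its inverse and fixes the third pointwise. -/
lemma measurePreserving_swapEquiv (he : MeasurePreserving e μ μ) :
    MeasurePreserving (swapEquiv e hM hd) μ μ := by
  refine ⟨(swapEquiv e hM hd).measurable, ?_⟩
  ext A hA
  set s := swapEquiv e hM hd with hs
  rw [Measure.map_apply s.measurable hA]
  have hM' : MeasurableSet (e.symm ⁻¹' M) := e.symm.measurable hM
  have hdisj : ∀ x, e.symm x ∈ M → x ∉ M := fun x hx h => by
    simpa using hd _ hx (by simpa using h)
  rw [← measure_inter_add_sdiff (s ⁻¹' A) hM, ← measure_inter_add_sdiff (s ⁻¹' A \ M) hM',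
    ← measure_inter_add_sdiff A hM, ← measure_inter_add_sdiff (A \ M) hM', ← add_assoc,
    ← add_assoc]
  have h1 : s ⁻¹' A ∩ M = e ⁻¹' ((A \ M) ∩ e.symm ⁻¹' M) := by
    ext x
    simp only [Set.mem_inter_iff, Set.mem_preimage, Set.mem_sdiff, MeasurableEquiv.symm_apply_apply]
    constructor
    · rintro ⟨h, hx⟩
      rw [hs, swapEquiv_of_mem e hM hd hx] at h
      exact ⟨⟨h, hd x hx⟩, hx⟩
    · rintro ⟨⟨h, -⟩, hx⟩
      rw [hs, swapEquiv_of_mem e hM hd hx]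
      exact ⟨h, hx⟩
  have h2 : (s ⁻¹' A \ M) ∩ e.symm ⁻¹' M = e.symm ⁻¹' (A ∩ M) := by
    ext x
    simp only [Set.mem_inter_iff, Set.mem_preimage, Set.mem_sdiff]
    constructor
    · rintro ⟨⟨h, -⟩, hx⟩
      rw [hs, swapEquiv_of_symm_mem e hM hd hx] at h
      exact ⟨h, hx⟩
    · rintro ⟨h, hx⟩
      rw [hs, swapEquiv_of_symm_mem e hM hd hx]
      exact ⟨⟨h, hdisj x hx⟩, hx⟩
  have h3 : (s ⁻¹' A \ M) \ e.symm ⁻¹' M = (A \ M) \ e.symm ⁻¹' M := by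
    ext x
    simp only [Set.mem_preimage, Set.mem_sdiff]
    constructor
    · rintro ⟨⟨h, h1⟩, h2⟩
      rw [hs, swapEquiv_of_notMem e hM hd h1 h2] at h
      exact ⟨⟨h, h1⟩, h2⟩
    · rintro ⟨⟨h, h1⟩, h2⟩
      rw [hs, swapEquiv_of_notMem e hM hd h1 h2]
      exact ⟨⟨h, h1⟩, h2⟩
  rw [h1, h2, h3, he.measure_preimage ((hA.diff hM).inter hM').nullMeasurableSet,
    (he.symm e).measure_preimage (hA.inter hM).nullMeasurableSet]
  congr 1
  exact add_comm _ _

end swapEquiv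

lemma exists_iterate_measurableEquiv (τ : Automorphisms μ) (i : ℕ) :
    ∃ e : X ≃ᵐ X, MeasurePreserving e μ μ ∧ ⇑e = τ.1^[i] := by
  induction i with
  | zero => exact ⟨MeasurableEquiv.refl X, MeasurePreserving.id μ, rfl⟩
  | succ i ih =>
    obtain ⟨e, he, h⟩ := ih
    refine ⟨τ.1.trans e, he.comp τ.2, ?_⟩
    rw [Function.iterate_succ, ← h]
    rfl

variable [IsProbabilityMeasure μ]

/-- A set can be rearranged inside the cells of a finite partition so as to be, up to a small
error, comparable with a given set in each cell. -/
lemma exists_rearrangement {τ : Automorphisms μ} (hτ : IsWeakMixing μ τ.1) {ι : Type*}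
    {B : ι → Set X} (hB : ∀ i, MeasurableSet (B i))
    (hBd : Pairwise (Function.onFun Disjoint B)) {D F : Set X} (hD : MeasurableSet D)
    (hF : MeasurableSet F) {η : ℝ} (hη : 0 < η) :
    ∃ ψ : Automorphisms μ, (∀ i x, ψ.1 x ∈ B i ↔ x ∈ B i) ∧
      ∀ i, min (μ.real (B i ∩ (ψ.1.symm ⁻¹' D \ F))) (μ.real (B i ∩ (F \ ψ.1.symm ⁻¹' D))) ≤
        η := by
  let P : Set (Automorphisms μ) := {ψ | ∀ i x, ψ.1 x ∈ B i ↔ x ∈ B i}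
  let v : Automorphisms μ → ℝ := fun ψ => μ.real (ψ.1.symm ⁻¹' D ∩ F)
  have hne : (v '' P).Nonempty :=
    ⟨_, ⟨⟨MeasurableEquiv.refl X, MeasurePreserving.id μ⟩, fun i x => Iff.rfl, rfl⟩⟩
  have hbdd : BddAbove (v '' P) := ⟨1, by rintro _ ⟨ψ, -, rfl⟩; exact measureReal_le_one⟩
  -- Choose ψ within η² of maximizing μ(ψD ∩ F). If both differences exceeded η in some cell, a swap
  -- inside that cell would gain more than η².
  obtain ⟨_, ⟨ψ, hψ, rfl⟩, hsup⟩ := exists_lt_of_lt_csSup hne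
    (show sSup (v '' P) - η ^ 2 < sSup (v '' P) by linarith [pow_pos hη 2])
  refine ⟨ψ, hψ, fun i => ?_⟩
  by_contra! hlt
  rw [lt_min_iff] at hlt
  set E := ψ.1.symm ⁻¹' D with hE
  have hEm : MeasurableSet E := ψ.1.symm.measurable hD
  set U := B i ∩ (E \ F) with hU
  set U' := B i ∩ (F \ E) with hU'
  have hUm : MeasurableSet U := (hB i).inter (hEm.diff hF)
  have hUm' : MeasurableSet U' := (hB i).inter (hF.diff hEm)
  have hprod : η ^ 2 < μ.real U * μ.real U' := by
    rw [sq]; exact mul_lt_mul'' hlt.1 hlt.2 hη.le hη.le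
  -- The tolerance μ(U)μ(U') - η² leaves more than η² of U carried into U' by τ^k.
  obtain ⟨k, hk⟩ := hτ.exists_correlation_lt (ι := Unit) (W := fun _ => U) (K := fun _ => U')
    (fun _ => hUm) (fun _ => hUm') (sub_pos.2 hprod)
  obtain ⟨e, he, hek⟩ := exists_iterate_measurableEquiv τ k
  have hk := hk ()
  rw [← hek] at hk
  set M := U ∩ e ⁻¹' U' with hMdef
  have hM : MeasurableSet M := hUm.inter (e.measurable hUm')
  have hMη : η ^ 2 < μ.real M := by
    have := (abs_lt.1 hk).1
    linarith
  have hd : ∀ x ∈ M, e x ∉ M := fun x hx h => h.1.2.2 hx.2.2.1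
  set s := swapEquiv e hM hd with hs
  let ψ' : Automorphisms μ := ⟨ψ.1.trans s, (measurePreserving_swapEquiv e hM hd he).comp ψ.2⟩
  have hcell : ∀ {j x}, x ∈ B i → (x ∈ B j ↔ j = i) := by
    intro j x hx
    refine ⟨fun h => ?_, fun h => h ▸ hx⟩
    by_contra hne
    exact Set.disjoint_left.1 (hBd hne) h hx
  have hψ' : ψ' ∈ P := by
    intro j x
    rw [← hψ j x]
    change s (ψ.1 x) ∈ B j ↔ _
    generalize ψ.1 x = y
    by_cases h1 : y ∈ M
    · rw [hs, swapEquiv_of_mem e hM hd h1, hcell h1.2.1, hcell h1.1.1]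
    · by_cases h2 : e.symm y ∈ M
      · have := h2.2.1
        simp only [MeasurableEquiv.apply_symm_apply] at this
        rw [hs, swapEquiv_of_symm_mem e hM hd h2, hcell h2.1.1, hcell this]
      · rw [hs, swapEquiv_of_notMem e hM hd h1 h2]
  -- The swap trades M, lying in E outside F, for its image, lying in F outside E; E ∩ F is
  -- untouched.
  have hv' : v ψ + μ.real M ≤ v ψ' := by
    have hMe : μ.real M = μ.real (e.symm ⁻¹' M) :=
      ((he.symm e).measureReal_preimage hM.nullMeasurableSet).symm
    have hsymm : ∀ {y}, e.symm y ∈ M → y ∈ U' := by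
      intro y hy
      simpa using hy.2
    rw [hMe, ← measureReal_union (Set.disjoint_left.2 ?_) (e.symm.measurable hM)]
    · refine measureReal_mono ?_
      rintro y (hy | hy)
      · refine ⟨?_, hy.2⟩
        change ψ.1.symm (s.symm y) ∈ D
        rw [hs, swapEquiv_symm, swapEquiv_of_notMem e hM hd (fun h => h.1.2.2 hy.2)
          (fun h => (hsymm h).2.2 hy.1)]
        exact hy.1
      · refine ⟨?_, (hsymm hy).2.1⟩
        change ψ.1.symm (s.symm y) ∈ D
        rw [hs, swapEquiv_symm, swapEquiv_of_symm_mem e hM hd hy]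
        exact hy.1.2.1
    · exact fun y hy h => (hsymm h).2.2 hy.1
  have := le_csSup hbdd ⟨ψ', hψ', rfl⟩
  linarith

end Rearrangement

end UniformMixing

/-! ### Correlation with an almost invariant set obstructs mixing -/

namespace UniformMixing

variable {X : Type*} [MeasurableSpace X] {μ : Measure X} [IsProbabilityMeasure μ]

/-- The self-correlation `μ(E ∩ T⁻ⁱE) - μ(E)²`. -/
noncomputable def autoCorrelation (μ : Measure X) (T : X → X) (E : Set X) (i : ℕ) : ℝ :=
  μ.real (E ∩ T^[i] ⁻¹' E) - μ.real E * μ.real E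

/-- For fixed j < n the lags j - i run once through 0, …, j. -/
lemma sum_sum_autoCorrelation_le (b : ℕ → ℝ) (hb : ∀ i, 0 ≤ b i) (n : ℕ) :
    ∑ i ∈ Finset.range n, ∑ j ∈ Finset.range n, (if i ≤ j then b (j - i) else 0) ≤
      n * ∑ i ∈ Finset.range n, b i := by
  rw [Finset.sum_comm, ← nsmul_eq_mul]
  conv_rhs => rw [← Finset.card_range n]
  refine Finset.sum_le_card_nsmul _ _ _ fun j hj => ?_
  rw [← Finset.sum_filter]
  have : (Finset.range n).filter (fun i => i ≤ j) = Finset.range (j + 1) := by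
    ext i
    simp only [Finset.mem_filter, Finset.mem_range] at *
    omega
  rw [this, Finset.card_range, ← Finset.sum_range_reflect]
  refine (Finset.sum_congr rfl fun i hi => ?_).trans_le
    (Finset.sum_le_sum_of_subset_of_nonneg (f := b)
      (Finset.range_subset_range.2 (by simp at hj; omega)) fun i _ _ => hb i)
  congr 1
  simp at hi
  omega

/-- An almost invariant set that is correlated with `E` prevents `E` from mixing fast. -/
lemma sq_le_two_mul_mixingAverage {T : X → X} (hT : MeasurePreserving T μ μ) {E F : Set X}
    (hE : MeasurableSet E) (hF : MeasurableSet F) {δ a : ℝ} (hFδ : μ.real (F ∆ (T ⁻¹' F)) ≤ δ)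
    {n : ℕ} (hn : 0 < n) (ha : 0 ≤ a)
    (haE : a + n * δ ≤ μ.real (E ∩ F) - μ.real E * μ.real F) :
    a ^ 2 ≤ 2 * mixingAverage μ T E E n := by
  have hn' : (0 : ℝ) < n := by exact_mod_cast hn
  have hδ : 0 ≤ δ := measureReal_nonneg.trans hFδ
  have hEi : ∀ i, MeasurableSet (T^[i] ⁻¹' E) := fun i => hT.measurable.iterate i hE
  have hμi : ∀ i, μ.real (T^[i] ⁻¹' E) = μ.real E := fun i =>
    (hT.iterate i).measureReal_preimage hE.nullMeasurableSet
  let u : ℕ → X → ℝ := fun i => (T^[i] ⁻¹' E).indicator 1 - fun _ => μ.real E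
  let w : X → ℝ := F.indicator 1
  have hind : ∀ {A B : Set X}, MeasurableSet A → MeasurableSet B →
      ∫ x, A.indicator (1 : X → ℝ) x * B.indicator 1 x ∂μ = μ.real (A ∩ B) := by
    intro A B hA hB
    rw [← integral_indicator_one (hA.inter hB), Set.inter_indicator_one]
    rfl
  have hI1 : ∀ {A : Set X}, MeasurableSet A → Integrable (A.indicator (1 : X → ℝ)) μ :=
    fun hA => (integrable_const (1 : ℝ)).indicator hA
  have hI2 : ∀ {A B : Set X}, MeasurableSet A → MeasurableSet B →
      Integrable (fun x => A.indicator (1 : X → ℝ) x * B.indicator 1 x) μ := by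
    intro A B hA hB
    have := hI1 (hA.inter hB)
    rw [Set.inter_indicator_one] at this
    exact this
  have huu : ∀ i j, Integrable (fun x => u i x * u j x) μ ∧ ∫ x, u i x * u j x ∂μ =
      μ.real (T^[i] ⁻¹' E ∩ T^[j] ⁻¹' E) - μ.real E * μ.real E := by
    intro i j
    have : (fun x => u i x * u j x) = fun x => (((T^[i] ⁻¹' E).indicator (1 : X → ℝ) x *
        (T^[j] ⁻¹' E).indicator 1 x - μ.real E * (T^[i] ⁻¹' E).indicator (1 : X → ℝ) x) -
        μ.real E * (T^[j] ⁻¹' E).indicator (1 : X → ℝ) x) + μ.real E * μ.real E := by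
      funext x
      simp only [u, Pi.sub_apply]
      ring
    rw [this]
    have i1 := hI2 (hEi i) (hEi j)
    have i2 := (hI1 (hEi i)).const_mul (μ.real E)
    have i3 := (hI1 (hEi j)).const_mul (μ.real E)
    have i12 : Integrable (fun x => (T^[i] ⁻¹' E).indicator (1 : X → ℝ) x *
        (T^[j] ⁻¹' E).indicator 1 x - μ.real E * (T^[i] ⁻¹' E).indicator (1 : X → ℝ) x) μ :=
      i1.sub i2
    have i123 : Integrable (fun x => ((T^[i] ⁻¹' E).indicator (1 : X → ℝ) x *
        (T^[j] ⁻¹' E).indicator 1 x - μ.real E * (T^[i] ⁻¹' E).indicator (1 : X → ℝ) x) -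
        μ.real E * (T^[j] ⁻¹' E).indicator (1 : X → ℝ) x) μ := i12.sub i3
    refine ⟨i123.add (integrable_const _), ?_⟩
    rw [integral_add i123 (integrable_const _), integral_sub i12 i3,
      integral_sub i1 i2, hind (hEi i) (hEi j), integral_const_mul, integral_const_mul,
      integral_indicator_one (hEi i), integral_indicator_one (hEi j), hμi, hμi]
    simp
  have huw : ∀ i, Integrable (fun x => u i x * w x) μ ∧ ∫ x, u i x * w x ∂μ =
      μ.real (T^[i] ⁻¹' E ∩ F) - μ.real E * μ.real F := by
    intro i
    have : (fun x => u i x * w x) = fun x => (T^[i] ⁻¹' E).indicator (1 : X → ℝ) x *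
        F.indicator 1 x - μ.real E * F.indicator (1 : X → ℝ) x := by
      funext x
      simp only [u, w, Pi.sub_apply]
      ring
    rw [this]
    have i1 := hI2 (hEi i) hF
    have i2 := (hI1 hF).const_mul (μ.real E)
    refine ⟨i1.sub i2, ?_⟩
    rw [integral_sub i1 i2, hind (hEi i) hF, integral_const_mul, integral_indicator_one hF]
  have hFi : ∀ i : ℕ, μ.real (F ∆ (T^[i] ⁻¹' F)) ≤ i * δ := by
    intro i
    induction i with
    | zero => simp
    | succ i ih =>
      refine (measureReal_symmDiff_le (μ := μ) (s := F) (t := T^[i] ⁻¹' F)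
        (T^[i + 1] ⁻¹' F)).trans ?_
      rw [Function.iterate_succ', Set.preimage_comp, ← Set.preimage_symmDiff,
        (hT.iterate i).measureReal_preimage
          (hF.symmDiff (hT.measurable hF)).nullMeasurableSet]
      push_cast
      linarith
  have hcorr : ∀ i ∈ Finset.range n, a ≤ μ.real (T^[i] ⁻¹' E ∩ F) - μ.real E * μ.real F := by
    intro i hi
    have h1 : μ.real (E ∩ F) ≤ μ.real (T^[i] ⁻¹' E ∩ F) + i * δ := by
      rw [← (hT.iterate i).measureReal_preimage (hE.inter hF).nullMeasurableSet]
      refine (measureReal_mono (μ := μ) (s₂ := (T^[i] ⁻¹' E ∩ F) ∪ (F ∆ (T^[i] ⁻¹' F))) ?_).trans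
        ((measureReal_union_le _ _).trans (add_le_add_right (hFi i) _))
      intro x
      simp only [Set.mem_preimage, Set.mem_inter_iff, Set.mem_union, Set.mem_symmDiff]
      tauto
    have h2 : (i : ℝ) * δ ≤ n * δ :=
      mul_le_mul_of_nonneg_right (by exact_mod_cast (Finset.mem_range.1 hi).le) hδ
    linarith
  let I : ℝ := ∑ i ∈ Finset.range n, (μ.real (T^[i] ⁻¹' E ∩ F) - μ.real E * μ.real F)
  have hI : n * a ≤ I := by
    have := Finset.card_nsmul_le_sum _ _ _ hcorr
    rwa [Finset.card_range, nsmul_eq_mul] at this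
  let Q : ℝ := ∑ i ∈ Finset.range n, ∑ j ∈ Finset.range n,
    (μ.real (T^[i] ⁻¹' E ∩ T^[j] ⁻¹' E) - μ.real E * μ.real E)
  -- Cauchy–Schwarz by completing the square: I is the integral of (∑ u i) w, and ∫ w² = μ(F) ≤ 1,
  -- so nonnegativity yields I² ≤ Q.
  have hexp : ∫ x, (∑ i ∈ Finset.range n, u i x - I * w x) ^ 2 ∂μ =
      Q - 2 * I * I + I ^ 2 * μ.real F := by
    have : (fun x => (∑ i ∈ Finset.range n, u i x - I * w x) ^ 2) = fun x =>
        (∑ i ∈ Finset.range n, ∑ j ∈ Finset.range n, u i x * u j x -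
          2 * I * ∑ i ∈ Finset.range n, u i x * w x) + I ^ 2 * (w x * w x) := by
      funext x
      rw [← Finset.sum_mul, ← Finset.sum_mul_sum]
      ring
    rw [this]
    have i1 : Integrable (fun x => ∑ i ∈ Finset.range n, ∑ j ∈ Finset.range n, u i x * u j x) μ :=
      integrable_finsetSum _ fun i _ => integrable_finsetSum _ fun j _ => (huu i j).1
    have i2 : Integrable (fun x => 2 * I * ∑ i ∈ Finset.range n, u i x * w x) μ :=
      (integrable_finsetSum _ fun i _ => (huw i).1).const_mul _
    have i3 : Integrable (fun x => I ^ 2 * (w x * w x)) μ := (hI2 hF hF).const_mul _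
    have i12 : Integrable (fun x => ∑ i ∈ Finset.range n, ∑ j ∈ Finset.range n, u i x * u j x -
      2 * I * ∑ i ∈ Finset.range n, u i x * w x) μ := i1.sub i2
    rw [integral_add i12 i3, integral_sub i1 i2, integral_const_mul, integral_const_mul,
      hind hF hF, Set.inter_self, integral_finsetSum _ fun i _ => (huw i).1,
      integral_finsetSum _ fun i _ => integrable_finsetSum _ fun j _ => (huu i j).1]
    simp only [(huw _).2, integral_finsetSum _ fun j _ => (huu _ j).1, (huu _ _).2]
    rfl
  have hQ : I ^ 2 ≤ Q := by
    have h0 : 0 ≤ ∫ x, (∑ i ∈ Finset.range n, u i x - I * w x) ^ 2 ∂μ :=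
      integral_nonneg fun x => sq_nonneg _
    have h1 : μ.real F ≤ 1 := measureReal_le_one
    rw [hexp] at h0
    nlinarith [sq_nonneg I]
  have hle : ∀ {i j : ℕ}, i ≤ j → μ.real (T^[i] ⁻¹' E ∩ T^[j] ⁻¹' E) - μ.real E * μ.real E =
      autoCorrelation μ T E (j - i) := by
    intro i j hij
    have : T^[i] ⁻¹' E ∩ T^[j] ⁻¹' E = T^[i] ⁻¹' (E ∩ T^[j - i] ⁻¹' E) := by
      rw [Set.preimage_inter, ← Set.preimage_comp, ← Function.iterate_add, Nat.sub_add_cancel hij]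
    rw [this, (hT.iterate i).measureReal_preimage (hE.inter (hEi _)).nullMeasurableSet]
    rfl
  let b : ℕ → ℝ := fun i => |autoCorrelation μ T E i|
  have hb : ∀ i, 0 ≤ b i := fun i => abs_nonneg _
  -- By invariance each entry depends only on the lag. The sums over i ≤ j and j ≤ i cover all
  -- pairs; counting the diagonal twice is harmless.
  have hQ2 : Q ≤ 2 * (n * ∑ i ∈ Finset.range n, b i) := by
    have h1 := sum_sum_autoCorrelation_le b hb n
    have h2 := h1
    rw [Finset.sum_comm] at h2
    have : Q ≤ ∑ i ∈ Finset.range n, ∑ j ∈ Finset.range n, (if i ≤ j then b (j - i) else 0) +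
        ∑ i ∈ Finset.range n, ∑ j ∈ Finset.range n, (if j ≤ i then b (i - j) else 0) := by
      rw [← Finset.sum_add_distrib]
      refine Finset.sum_le_sum fun i _ => ?_
      rw [← Finset.sum_add_distrib]
      refine Finset.sum_le_sum fun j _ => ?_
      rcases le_total i j with h | h
      · rw [hle h, if_pos h]
        refine (le_abs_self _).trans (le_add_of_nonneg_right ?_)
        split_ifs
        exacts [hb _, le_rfl]
      · rw [Set.inter_comm, hle h, if_pos h]
        refine (le_abs_self _).trans (le_add_of_nonneg_left ?_)
        split_ifs
        exacts [hb _, le_rfl]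
    linarith
  have hmix : ∑ i ∈ Finset.range n, b i = n * mixingAverage μ T E E n := by
    rw [mixingAverage, mul_div_cancel₀ _ hn'.ne']
    rfl
  have hnI : (n * a) ^ 2 ≤ I ^ 2 := pow_le_pow_left₀ (by positivity) hI 2
  have : (n : ℝ) ^ 2 * a ^ 2 ≤ n ^ 2 * (2 * mixingAverage μ T E E n) := by
    rw [hmix] at hQ2
    nlinarith
  exact le_of_mul_le_mul_left this (by positivity)

lemma preimage_joinCell {Y Z : Type*} (f : Y → Z) {n : ℕ} (B : Fin n → Set Z) (σ : Fin n → Bool) :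
    joinCell (fun i => f ⁻¹' B i) σ = f ⁻¹' joinCell B σ := by
  ext x
  simp only [joinCell, Set.mem_iInter, Set.mem_preimage]
  refine forall_congr' fun i => ?_
  split_ifs <;> rfl

lemma mem_iff_of_forall_joinCell {Z : Type*} {f : Z → Z} {n : ℕ} {B : Fin n → Set Z}
    (h : ∀ σ x, f x ∈ joinCell B σ ↔ x ∈ joinCell B σ) (i : Fin n) (x : Z) :
    f x ∈ B i ↔ x ∈ B i := by
  classical
  have hx : x ∈ joinCell B fun i => decide (x ∈ B i) := by
    simp only [joinCell, Set.mem_iInter]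
    intro i
    by_cases hi : x ∈ B i <;> simp [hi]
  have hfx := (h _ x).2 hx
  simp only [joinCell, Set.mem_iInter] at hfx
  have := hfx i
  by_cases hi : x ∈ B i <;> simp_all

/-- In a cell of mass p, let d be the mass of D and of its rearrangement E, f that of F, g that of E
∩ F. If E is nearly inside F, then g - dκ is about d(1 - κ); if F is nearly inside E, then g is
about f, hence about pκ, and g - dκ is about d'κ. -/
lemma cell_correlation_le {p d d' f g κ κ' δ η : ℝ} (hd : 0 ≤ d) (hd' : 0 ≤ d')
    (hp : d + d' = p) (hκ : κ' ≤ κ) (hκ' : κ' ≤ 1 - κ) (hκ0 : 0 ≤ κ') (hδ : 0 ≤ δ)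
    (hg : min (d - g) (f - g) ≤ η) (hf : |f - p * κ| ≤ δ) :
    κ' * min d d' ≤ g - d * κ + (η + δ) := by
  have h := (abs_le.1 hf).1
  rcases min_le_iff.1 hg with hg | hg
  · have := mul_le_mul_of_nonneg_left (min_le_left d d') hκ0
    nlinarith
  · have := mul_le_mul_of_nonneg_left (min_le_right d d') hκ0
    nlinarith

/-- One step of the construction: an automorphism is modified, without changing the images and
preimages of finitely many given sets, so that the image of some member of `𝒞` mixes badly at a
prescribed time. -/
lemma exists_modification {τ : Automorphisms μ} (hτ : IsWeakMixing μ τ.1)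
    (hsmall : ∀ ε > 0, ∃ A, MeasurableSet A ∧ 0 < μ.real A ∧ μ.real A < ε) {K : Set X}
    (hK : MeasurableSet K) {κ' : ℝ} (hκ0 : 0 < κ') (hκ : κ' ≤ μ.real K)
    (hκ' : κ' ≤ 1 - μ.real K) {𝒞 : Set (Set X)} (h𝒞 : ∀ C ∈ 𝒞, MeasurableSet C) {c : ℝ}
    (hc : 0 < c) (h : ∀ m (B : Fin m → Set X), (∀ i, MeasurableSet (B i)) →
      ∃ C ∈ 𝒞, c ≤ splitSize μ (joinCell B) C)
    (φ : Automorphisms μ) {L : List (Set X)} (hL : ∀ A ∈ L, MeasurableSet A) {n : ℕ}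
    (hn : 0 < n) :
    ∃ φ' : Automorphisms μ, ∃ C ∈ 𝒞,
      (∀ A ∈ L, φ'.1.symm ⁻¹' A = φ.1.symm ⁻¹' A ∧ φ'.1 ⁻¹' A = φ.1 ⁻¹' A) ∧
      (κ' * c / 4) ^ 2 / 2 ≤
        mixingAverage μ τ.1 (φ'.1.symm ⁻¹' C) (φ'.1.symm ⁻¹' C) n := by
  -- The new automorphism is ψ ∘ φ. Images of A survive if ψ preserves φA, preimages if ψ preserves
  -- A.
  let L' : List (Set X) := L.map (fun A => φ.1.symm ⁻¹' A) ++ L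
  have hL' : ∀ A ∈ L', MeasurableSet A := by
    intro A hA
    rcases List.mem_append.1 hA with hA | hA
    · obtain ⟨A', hA', rfl⟩ := List.mem_map.1 hA
      exact φ.1.symm.measurable (hL A' hA')
    · exact hL A hA
  let B : Fin L'.length → Set X := fun i => L'[i]
  have hB : ∀ i, MeasurableSet (B i) := fun i => hL' _ (List.getElem_mem _)
  -- Use the pulled-back partition, so that it is φC which cuts the join of B by at least c.
  obtain ⟨C, hC, hCc⟩ := h _ (fun i => φ.1 ⁻¹' B i) fun i => φ.1.measurable (hB i)
  have hCm := h𝒞 C hC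
  set D := φ.1.symm ⁻¹' C with hD
  have hDm : MeasurableSet D := φ.1.symm.measurable hCm
  have hφ : ∀ A : Set X, MeasurableSet A → μ.real (φ.1 ⁻¹' A) = μ.real A := fun A hA =>
    φ.2.measureReal_preimage hA.nullMeasurableSet
  have hBσ := measurableSet_joinCell hB
  have hsplit : splitSize μ (joinCell fun i => φ.1 ⁻¹' B i) C = splitSize μ (joinCell B) D := by
    simp only [splitSize]
    refine Finset.sum_congr rfl fun σ _ => ?_
    have hpre : φ.1 ⁻¹' D = C := by
      ext x
      simp [hD]
    rw [preimage_joinCell, ← hφ _ ((hBσ σ).inter hDm), ← hφ _ ((hBσ σ).diff hDm),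
      Set.preimage_inter, Set.preimage_sdiff, hpre]
  rw [hsplit] at hCc
  let N : ℝ := Fintype.card (Fin L'.length → Bool)
  have hN : 0 ≤ N := Nat.cast_nonneg _
  have hn' : (0 : ℝ) < n := by exact_mod_cast hn
  -- The N cells lose 2Nδ, replacing μ(K) by μ(F) loses Nδ, and the drift of F over n steps loses
  -- nδ: at most κ'c/2 in all, leaving more than the κ'c/4 used.
  let δ : ℝ := κ' * c / (6 * N + 4 * n)
  have hδ : 0 < δ := by positivity
  have hδe : δ * (6 * N + 4 * n) = κ' * c := div_mul_cancel₀ _ (by positivity)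
  obtain ⟨F, hF, hFδ, hFB⟩ := hτ.exists_almostInvariant hsmall hK hBσ hδ
  obtain ⟨ψ, hψ, hψF⟩ := exists_rearrangement hτ hBσ (pairwise_disjoint_joinCell B) hDm hF hδ
  set E := ψ.1.symm ⁻¹' D with hE
  have hEm : MeasurableSet E := ψ.1.symm.measurable hDm
  have hcell : ∀ σ, κ' * min (μ.real (joinCell B σ ∩ D)) (μ.real (joinCell B σ \ D)) ≤
      μ.real ((E ∩ F) ∩ joinCell B σ) - μ.real (E ∩ joinCell B σ) * μ.real K + (δ + δ) := by
    intro σ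
    have hd : μ.real (joinCell B σ ∩ D) = μ.real (E ∩ joinCell B σ) := by
      rw [← ψ.2.measureReal_preimage (hEm.inter (hBσ σ)).nullMeasurableSet]
      congr 1
      ext x
      simp [hE, hψ, and_comm]
    rw [← hd]
    refine cell_correlation_le measureReal_nonneg measureReal_nonneg
      (measureReal_inter_add_sdiff hDm) hκ hκ' hκ0.le hδ.le ?_ (hFB σ)
    convert! hψF σ using 2
    · rw [hd, ← measureReal_inter_add_sdiff (μ := μ) (s := E ∩ joinCell B σ) hF,
        Set.inter_right_comm, add_sub_cancel_left, Set.inter_comm E, Set.inter_sdiff_assoc]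
    · rw [← measureReal_inter_add_sdiff (μ := μ) (s := joinCell B σ ∩ F) hEm,
        Set.inter_assoc, Set.inter_comm F E, Set.inter_comm _ (E ∩ F), add_sub_cancel_left,
        Set.inter_sdiff_assoc]
  have hsum1 : κ' * c ≤ μ.real (E ∩ F) - μ.real E * μ.real K + N * (δ + δ) := by
    have h1 := Finset.sum_le_sum fun σ (_ : σ ∈ Finset.univ) => hcell σ
    rw [← Finset.mul_sum, Finset.sum_add_distrib, Finset.sum_sub_distrib, ← Finset.sum_mul,
      sum_measureReal_inter_joinCell hB, sum_measureReal_inter_joinCell hB, Finset.sum_const,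
      Finset.card_univ, nsmul_eq_mul] at h1
    exact (mul_le_mul_of_nonneg_left hCc hκ0.le).trans h1
  have hsum2 : μ.real F ≤ μ.real K + N * δ := by
    have h1 : ∀ σ ∈ Finset.univ, μ.real (F ∩ joinCell B σ) ≤
        μ.real (Set.univ ∩ joinCell B σ) * μ.real K + δ := by
      intro σ _
      have := (abs_le.1 (hFB σ)).2
      rw [Set.inter_comm, Set.univ_inter]
      linarith
    have h2 := Finset.sum_le_sum h1
    rwa [Finset.sum_add_distrib, ← Finset.sum_mul, sum_measureReal_inter_joinCell hB,
      sum_measureReal_inter_joinCell hB, Finset.sum_const, Finset.card_univ, nsmul_eq_mul,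
      probReal_univ, one_mul] at h2
  have hE0 : 0 ≤ μ.real E := measureReal_nonneg
  have hE1 : μ.real E ≤ 1 := measureReal_le_one
  have hNδ : 0 ≤ N * δ := by positivity
  have hmix := sq_le_two_mul_mixingAverage (a := κ' * c / 4) hτ.measurePreserving hEm hF hFδ hn
    (by positivity) (by nlinarith)
  refine ⟨⟨φ.1.trans ψ.1, ψ.2.comp φ.2⟩, C, hC, fun A hA => ?_, ?_⟩
  · have key : ∀ A ∈ L', ∀ x, ψ.1 x ∈ A ↔ x ∈ A := by
      intro A hA x
      obtain ⟨i, hi, rfl⟩ := List.getElem_of_mem hA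
      exact mem_iff_of_forall_joinCell hψ ⟨i, hi⟩ x
    constructor
    · ext y
      have := key _ (List.mem_append_left _ (List.mem_map_of_mem hA)) (ψ.1.symm y)
      rw [MeasurableEquiv.apply_symm_apply] at this
      exact this.symm
    · ext y
      exact key _ (List.mem_append_right _ hA) (φ.1 y)
  · change _ ≤ mixingAverage μ τ.1 E E n
    linarith

end UniformMixing

/-! ### Real coordinates on Lebesgue spaces -/

namespace UniformMixing

variable {X : Type*} [MeasurableSpace X] {μ : Measure X}

/-- A real coordinate on a measure space: a measurable function that is injective off a null set,
determines the measurable sets modulo null sets, and through which every function with the same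
law lifts to a measure preserving map. -/
structure IsCoordinate (μ : Measure X) (f : X → ℝ) : Prop where
  measurable : Measurable f
  injOn : ∃ X₀, μ X₀ᶜ = 0 ∧ Set.InjOn f X₀
  exists_preimage : ∀ S, MeasurableSet S → ∃ W, MeasurableSet W ∧ S =ᵐ[μ] f ⁻¹' W
  exists_lift : ∀ h : X → ℝ, Measurable h → μ.map h = μ.map f →
    ∃ θ, MeasurePreserving θ μ μ ∧ (fun x => f (θ x)) =ᵐ[μ] h

/-- Provides a bounded coordinate, as the limit construction needs. A function with the law of
arctan ∘ f lies a.e. in (-π/2, π/2), where arctan inverts tan. -/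
lemma IsCoordinate.arctan {f : X → ℝ} (hf : IsCoordinate μ f) :
    IsCoordinate μ fun x => Real.arctan (f x) := by
  have htan : Measurable Real.tan := by
    rw [show Real.tan = fun x => Real.sin x / Real.cos x from
      funext Real.tan_eq_sin_div_cos]
    exact Real.measurable_sin.div Real.measurable_cos
  have hm : Measurable fun x => Real.arctan (f x) := Real.measurable_arctan.comp hf.measurable
  refine ⟨hm, ?_, fun S hS => ?_, fun h hh hmap => ?_⟩
  · obtain ⟨X₀, h0, hi⟩ := hf.injOn
    exact ⟨X₀, h0, fun x hx y hy h => hi hx hy (Real.arctan_injective h)⟩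
  · obtain ⟨W, hW, h⟩ := hf.exists_preimage S hS
    refine ⟨Real.tan ⁻¹' W, htan hW, ?_⟩
    have : (fun x => Real.arctan (f x)) ⁻¹' (Real.tan ⁻¹' W) = f ⁻¹' W := by
      ext x
      simp
    rwa [this]
  · have hlaw : μ.map (fun x => Real.tan (h x)) = μ.map f := by
      have h1 := Measure.map_map (μ := μ) htan hh
      have h2 := Measure.map_map (μ := μ) htan hm
      rw [hmap, h2] at h1
      refine h1.symm.trans ?_
      congr 1
      funext x
      simp
    obtain ⟨θ, hθ, hfθ⟩ := hf.exists_lift _ (htan.comp hh) hlaw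
    refine ⟨θ, hθ, ?_⟩
    have hI : ∀ᵐ y ∂(μ.map h), y ∈ Set.Ioo (-(Real.pi / 2)) (Real.pi / 2) := by
      rw [hmap]
      exact (ae_map_iff hm.aemeasurable (p := fun y => y ∈ Set.Ioo _ _) measurableSet_Ioo).2
        (Eventually.of_forall fun x => Real.arctan_mem_Ioo _)
    have hI' := (ae_map_iff hh.aemeasurable (p := fun y => y ∈ Set.Ioo _ _)
      measurableSet_Ioo).1 hI
    filter_upwards [hfθ, hI'] with x h1 h2
    rw [h1, Function.comp_apply, Real.arctan_tan h2.1 h2.2]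

/-- Treats the Borel and the completed line together: measurable sets of Y are sandwiched between
Borel sets, which either coincide or come with a complete measure. The coordinate is ι ∘ e, and a
function h with its law lifts to e⁻¹ ∘ ι⁻¹ ∘ h. -/
lemma isCoordinate_of_isIsomorphicModNull [IsProbabilityMeasure μ] {Y : Type*}
    [MeasurableSpace Y] {ρ : Measure Y} (ι : Y ≃ ℝ) (hι : Measurable ι)
    (hs : ∀ Z, MeasurableSet Z → ∃ W₁ W₂, MeasurableSet W₁ ∧ MeasurableSet W₂ ∧ ι ⁻¹' W₁ ⊆ Z ∧
      Z ⊆ ι ⁻¹' W₂ ∧ ρ (ι ⁻¹' (W₂ \ W₁)) = 0 ∧ (W₁ = W₂ ∨ ρ.IsComplete))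
    (h : IsIsomorphicModNull μ ρ) : ∃ f, IsCoordinate μ f := by
  classical
  obtain ⟨X₀, Y₀, hX₀, hY₀, hμX, hρY, e, he⟩ := h
  let f : X → ℝ := fun x => if hx : x ∈ X₀ then ι (e ⟨x, hx⟩) else 0
  have hfm : Measurable f :=
    Measurable.dite (hι.comp (measurable_subtype_coe.comp e.measurable)) measurable_const hX₀
  have hfX : ∀ x : X₀, f x = ι (e x) := fun x => dif_pos x.2
  have hμe : ∀ Z, MeasurableSet Z →
      μ ((↑) '' (e ⁻¹' ((↑) ⁻¹' Z)) : Set X) = ρ Z := by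
    intro Z hZ
    have := he.measure_preimage (measurable_subtype_coe hZ).nullMeasurableSet
    rw [comap_subtype_coe_apply hX₀, comap_subtype_coe_apply hY₀,
      Subtype.image_preimage_coe] at this
    rw [this, Set.inter_comm]
    exact measure_inter_conull hρY
  have hX₀ae : ∀ᵐ x ∂μ, x ∈ X₀ := hμX
  have hnull : ∀ Z, MeasurableSet Z → ρ Z = 0 → ∀ᵐ x ∂μ, ∀ hx : x ∈ X₀, (e ⟨x, hx⟩ : Y) ∉ Z := by
    intro Z hZ h0
    rw [← hμe Z hZ] at h0
    filter_upwards [measure_eq_zero_iff_ae_notMem.1 h0] with x hx hx0 hxZ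
    exact hx ⟨⟨x, hx0⟩, hxZ, rfl⟩
  have hlaw : μ.map f = ρ.map ι := by
    ext W hW
    rw [Measure.map_apply hfm hW, Measure.map_apply hι hW, ← hμe _ (hι hW)]
    refine measure_congr ?_
    filter_upwards [hX₀ae] with x hx
    refine propext ⟨fun h => ⟨⟨x, hx⟩, ?_, rfl⟩, ?_⟩
    · have h : f x ∈ W := h
      rw [hfX ⟨x, hx⟩] at h
      exact h
    · rintro ⟨x, h, rfl⟩
      change f x ∈ W
      rw [hfX]
      exact h
  let Zf : Set X → Set Y := fun S => (↑) '' (e.symm ⁻¹' ((↑) ⁻¹' S))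
  have hZf : ∀ S, MeasurableSet S → MeasurableSet (Zf S) := fun S hS =>
    hY₀.subtype_image (e.symm.measurable (measurable_subtype_coe hS))
  have hZfmem : ∀ S (y : Y₀), (y : Y) ∈ Zf S ↔ (e.symm y : X) ∈ S := by
    intro S y
    simp [Zf]
  refine ⟨f, hfm, ⟨X₀, hμX, ?_⟩, ?_, ?_⟩
  · intro x hx y hy hxy
    have h1 := hfX ⟨x, hx⟩
    have h2 := hfX ⟨y, hy⟩
    rw [hxy, h2] at h1
    have := e.injective (Subtype.ext (ι.injective h1))
    exact (congrArg Subtype.val this).symm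
  · intro S hS
    obtain ⟨W₁, W₂, hW₁, hW₂, h1, h2, h0, -⟩ := hs _ (hZf S hS)
    refine ⟨W₁, hW₁, ?_⟩
    filter_upwards [hX₀ae, hnull _ (hι (hW₂.diff hW₁)) h0] with x hx hx0
    have hx0 := hx0 hx
    have key : x ∈ S ↔ (e ⟨x, hx⟩ : Y) ∈ Zf S := by simp [hZfmem]
    have hfx := hfX ⟨x, hx⟩
    refine propext ?_
    change x ∈ S ↔ f x ∈ W₁
    rw [key, hfx]
    refine ⟨fun h => ?_, fun h => h1 h⟩
    by_contra hn
    exact hx0 ⟨h2 h, hn⟩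
  · intro h hh hmap
    rw [hlaw] at hmap
    let k : X → Y := fun x => ι.symm (h x)
    have hk : ∀ W, k ⁻¹' (ι ⁻¹' W) = h ⁻¹' W := by
      intro W
      ext x
      simp [k]
    have hhW : ∀ W, MeasurableSet W → μ (h ⁻¹' W) = ρ (ι ⁻¹' W) := by
      intro W hW
      rw [← Measure.map_apply hh hW, hmap, Measure.map_apply hι hW]
    -- Measurability is claimed only inside X₀: completeness of ρ passes to X₀ through e, but
    -- nothing is known about subsets of the complement.
    have hkZ : ∀ Z, MeasurableSet Z → MeasurableSet (X₀ ∩ k ⁻¹' Z) ∧ μ (k ⁻¹' Z) = ρ Z := by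
      intro Z hZ
      obtain ⟨W₁, W₂, hW₁, hW₂, h1, h2, h0, hc⟩ := hs Z hZ
      have hρ : ρ (ι ⁻¹' W₂) ≤ ρ (ι ⁻¹' W₁) := by
        calc ρ (ι ⁻¹' W₂) ≤ ρ (ι ⁻¹' W₁ ∪ ι ⁻¹' (W₂ \ W₁)) := by
              refine measure_mono fun y hy => ?_
              by_cases hy1 : ι y ∈ W₁
              exacts [Or.inl hy1, Or.inr ⟨hy, hy1⟩]
          _ ≤ _ := (measure_union_le _ _).trans (by rw [h0, add_zero])
      have hm1 : h ⁻¹' W₁ ⊆ k ⁻¹' Z := by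
        rw [← hk]
        exact Set.preimage_mono h1
      have hm2 : k ⁻¹' Z ⊆ h ⁻¹' W₂ := by
        rw [← hk]
        exact Set.preimage_mono h2
      refine ⟨?_, le_antisymm ?_ ?_⟩
      · rcases hc with rfl | hc
        · rw [Set.Subset.antisymm hm2 hm1]
          exact hX₀.inter (hh hW₁)
        · let N : Set X := (k ⁻¹' Z) \ h ⁻¹' W₁
          have hN : MeasurableSet (X₀ ∩ N) := by
            have hN0 : μ (h ⁻¹' (W₂ \ W₁)) = 0 := by rw [hhW _ (hW₂.diff hW₁), h0]
            have hV := hZf _ (hh (hW₂.diff hW₁))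
            have hV0 : ρ (Zf (h ⁻¹' (W₂ \ W₁))) = 0 := by
              rw [← hμe _ hV]
              refine measure_mono_null ?_ hN0
              rintro _ ⟨x, hx, rfl⟩
              rw [Set.mem_preimage, Set.mem_preimage, hZfmem] at hx
              simpa using hx
            have hNm : MeasurableSet (Zf N) :=
              hc.out' _ (measure_mono_null (show Zf N ⊆ Zf (h ⁻¹' (W₂ \ W₁)) from
                Set.image_mono fun y (hy : (e.symm y : X) ∈ N) => ⟨hm2 hy.1, hy.2⟩) hV0)
            have : X₀ ∩ N = (↑) '' (e ⁻¹' ((↑) ⁻¹' Zf N) : Set X₀) := by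
              ext x
              constructor
              · rintro ⟨hx, hxN⟩
                refine ⟨⟨x, hx⟩, ?_, rfl⟩
                rw [Set.mem_preimage, Set.mem_preimage, hZfmem]
                simpa using hxN
              · rintro ⟨x, hx, rfl⟩
                rw [Set.mem_preimage, Set.mem_preimage, hZfmem] at hx
                exact ⟨x.2, by simpa using hx⟩
            rw [this]
            exact hX₀.subtype_image (e.measurable (measurable_subtype_coe hNm))
          have : X₀ ∩ k ⁻¹' Z = (X₀ ∩ h ⁻¹' W₁) ∪ (X₀ ∩ N) := by
            rw [← Set.inter_union_distrib_left, Set.union_sdiff_cancel hm1]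
          rw [this]
          exact (hX₀.inter (hh hW₁)).union hN
      · exact (measure_mono hm2).trans ((hhW _ hW₂).trans_le (hρ.trans (measure_mono h1)))
      · exact ((measure_mono h2).trans hρ).trans ((hhW _ hW₁).symm.trans_le (measure_mono hm1))
    let θ : X → X := fun x =>
      if hx : x ∈ X₀ ∧ k x ∈ Y₀ then (e.symm ⟨k x, hx.2⟩ : X) else x
    have hgood : ∀ᵐ x ∂μ, x ∈ X₀ ∧ k x ∈ Y₀ := by
      have : ∀ᵐ x ∂μ, k x ∉ Y₀ᶜ :=
        measure_eq_zero_iff_ae_notMem.1 ((hkZ _ hY₀.compl).2.trans hρY)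
      filter_upwards [hX₀ae, this] with x h1 h2
      exact ⟨h1, not_not.1 h2⟩
    have hθpre : ∀ S, θ ⁻¹' S = (X₀ ∩ k ⁻¹' Zf S) ∪ (S \ (X₀ ∩ k ⁻¹' Y₀)) := by
      intro S
      ext x
      by_cases hx : x ∈ X₀ ∧ k x ∈ Y₀
      · have h1 : θ x = e.symm ⟨k x, hx.2⟩ := dif_pos hx
        have h2 := hZfmem S ⟨k x, hx.2⟩
        simp only [Set.mem_preimage, Set.mem_union, Set.mem_inter_iff, Set.mem_sdiff, h1, h2, hx,
          true_and, not_true_eq_false, and_self, and_false, or_false]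
      · have h1 : θ x = x := dif_neg hx
        have h2 : k x ∈ Zf S → k x ∈ Y₀ := by
          rintro ⟨y, -, hy⟩
          rw [← hy]
          exact y.2
        simp only [Set.mem_preimage, Set.mem_union, Set.mem_inter_iff, Set.mem_sdiff, h1]
        tauto
    refine ⟨θ, ⟨?_, ?_⟩, ?_⟩
    · intro S hS
      rw [hθpre]
      exact (hkZ _ (hZf S hS)).1.union (hS.diff (hkZ _ hY₀).1)
    · ext S hS
      have hθm : Measurable θ := by
        intro S hS
        rw [hθpre]
        exact (hkZ _ (hZf S hS)).1.union (hS.diff (hkZ _ hY₀).1)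
      rw [Measure.map_apply hθm hS]
      calc μ (θ ⁻¹' S) = μ (k ⁻¹' Zf S) := by
            refine measure_congr ?_
            filter_upwards [hgood] with x hx
            refine propext ?_
            change x ∈ θ ⁻¹' S ↔ x ∈ k ⁻¹' Zf S
            rw [hθpre]
            simp only [Set.mem_preimage, Set.mem_union, Set.mem_inter_iff, Set.mem_sdiff]
            tauto
        _ = ρ (Zf S) := (hkZ _ (hZf S hS)).2
        _ = μ ((↑) '' (e ⁻¹' ((↑) ⁻¹' Zf S)) : Set X) := (hμe _ (hZf S hS)).symm
        _ = μ S := by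
            refine measure_congr ?_
            filter_upwards [hX₀ae] with x hx
            refine propext ⟨?_, fun h => ⟨⟨x, hx⟩, ?_, rfl⟩⟩
            · rintro ⟨x, h, rfl⟩
              rw [Set.mem_preimage, Set.mem_preimage, hZfmem] at h
              simp only [MeasurableEquiv.symm_apply_apply] at h
              exact h
            · rw [Set.mem_preimage, Set.mem_preimage, hZfmem]
              simp only [MeasurableEquiv.symm_apply_apply]
              exact h
    · filter_upwards [hgood] with x hx
      have h1 : θ x = e.symm ⟨k x, hx.2⟩ := dif_pos hx
      rw [h1, hfX]
      simp [k]

lemma IsLebesgueSpace.exists_isCoordinate [IsProbabilityMeasure μ] (h : IsLebesgueSpace μ) :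
    ∃ f, IsCoordinate μ f := by
  obtain ⟨ν, hν, h | h⟩ := h
  · exact isCoordinate_of_isIsomorphicModNull (Equiv.refl ℝ) measurable_id
      (fun Z hZ => ⟨Z, Z, hZ, hZ, subset_rfl, subset_rfl, by simp, Or.inl rfl⟩) h
  · let ι : NullMeasurableSpace ℝ ν ≃ ℝ := Equiv.refl ℝ
    have hι : Measurable ι := fun W hW => hW.nullMeasurableSet
    refine isCoordinate_of_isIsomorphicModNull ι hι (fun Z hZ => ?_) h
    have hZ : NullMeasurableSet (α := ℝ) Z ν := hZ
    obtain ⟨W₂, hW2, hm2, he2⟩ := hZ.exists_measurable_superset_ae_eq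
    obtain ⟨W₁, hW1, hm1, he1⟩ := hZ.exists_measurable_subset_ae_eq
    refine ⟨W₁, W₂, hm1, hm2, hW1, hW2, ?_, Or.inr inferInstance⟩
    exact ae_le_set.1 (he2.trans he1.symm).le

end UniformMixing

/-! ### Limits of automorphisms -/

namespace UniformMixing

variable {X : Type*} [MeasurableSpace X] {μ : Measure X}

/-- Two measure preserving maps that are inverse to each other almost everywhere agree almost
everywhere with an automorphism and its inverse. -/
lemma exists_automorphism_ae_eq {θ θ' : X → X} (hθ : MeasurePreserving θ μ μ)
    (hθ' : MeasurePreserving θ' μ μ) (h : ∀ᵐ x ∂μ, θ (θ' x) = x)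
    (h' : ∀ᵐ x ∂μ, θ' (θ x) = x) :
    ∃ φ : Automorphisms μ, φ.1 =ᵐ[μ] θ ∧ φ.1.symm =ᵐ[μ] θ' := by
  classical
  obtain ⟨N, hN, hNm, hN0⟩ := exists_measurable_superset_of_null (h.and h')
  let G := Nᶜ
  have hG : MeasurableSet G := hNm.compl
  have hGae : ∀ᵐ x ∂μ, x ∈ G := measure_eq_zero_iff_ae_notMem.1 hN0
  have hGs : ∀ x ∈ G, θ (θ' x) = x ∧ θ' (θ x) = x := fun x hx =>
    not_not.1 fun hn => hx (hN hn)
  -- The intersection of the Y n is conull and mapped into itself by θ and θ', so they are inverse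
  -- bijections there; the identity is used elsewhere.
  let Y : ℕ → Set X := Nat.rec G fun _ Z => Z ∩ (θ ⁻¹' Z ∩ θ' ⁻¹' Z)
  have hYs : ∀ n, Y (n + 1) = Y n ∩ (θ ⁻¹' Y n ∩ θ' ⁻¹' Y n) := fun n => rfl
  have hYm : ∀ n, MeasurableSet (Y n) := by
    intro n
    induction n with
    | zero => exact hG
    | succ n ih => exact ih.inter ((hθ.measurable ih).inter (hθ'.measurable ih))
  have hYae : ∀ n, ∀ᵐ x ∂μ, x ∈ Y n := by
    intro n
    induction n with
    | zero => exact hGae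
    | succ n ih =>
      filter_upwards [ih, hθ.quasiMeasurePreserving.ae ih, hθ'.quasiMeasurePreserving.ae ih]
        with x h1 h2 h3
      exact ⟨h1, h2, h3⟩
  let Z := ⋂ n, Y n
  have hZm : MeasurableSet Z := MeasurableSet.iInter hYm
  have hZae : ∀ᵐ x ∂μ, x ∈ Z := by
    filter_upwards [ae_all_iff.2 hYae] with x hx
    exact Set.mem_iInter.2 hx
  have hZθ : ∀ x ∈ Z, θ x ∈ Z := fun x hx =>
    Set.mem_iInter.2 fun n => (Set.mem_iInter.1 hx (n + 1)).2.1
  have hZθ' : ∀ x ∈ Z, θ' x ∈ Z := fun x hx =>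
    Set.mem_iInter.2 fun n => (Set.mem_iInter.1 hx (n + 1)).2.2
  have hZG : ∀ x ∈ Z, θ (θ' x) = x ∧ θ' (θ x) = x := fun x hx => hGs x (Set.mem_iInter.1 hx 0)
  let φ : X ≃ᵐ X :=
    { toFun := fun x => if x ∈ Z then θ x else x
      invFun := fun x => if x ∈ Z then θ' x else x
      left_inv := by
        intro x
        by_cases hx : x ∈ Z
        · simp [hx, hZθ x hx, (hZG x hx).2]
        · simp [hx]
      right_inv := by
        intro x
        by_cases hx : x ∈ Z
        · simp [hx, hZθ' x hx, (hZG x hx).1]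
        · simp [hx]
      measurable_toFun := Measurable.ite hZm hθ.measurable measurable_id
      measurable_invFun := Measurable.ite hZm hθ'.measurable measurable_id }
  have h1 : φ =ᵐ[μ] θ := by
    filter_upwards [hZae] with x hx
    exact if_pos hx
  have h2 : φ.symm =ᵐ[μ] θ' := by
    filter_upwards [hZae] with x hx
    exact if_pos hx
  exact ⟨⟨φ, hθ.congr φ.measurable h1.symm⟩, h1, h2⟩

/-- A bounded divergent sequence oscillates infinitely often across two rationals, which eventual
constancy of its side of each rational rules out. -/
lemma tendsto_of_forall_rat {u : ℕ → ℝ} {M : ℝ} (hM : ∀ n, |u n| ≤ M)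
    (h : ∀ q : ℚ, ∃ k, ∀ m ≥ k, u m ≤ q ↔ u k ≤ q) : ∃ l, Tendsto u atTop (𝓝 l) := by
  refine tendsto_of_no_upcrossings (s := Set.range ((↑) : ℚ → ℝ)) Rat.denseRange_cast ?_
    (isBoundedUnder_of ⟨M, fun n => (abs_le.1 (hM n)).2⟩)
    (isBoundedUnder_of ⟨-M, fun n => (abs_le.1 (hM n)).1⟩)
  rintro _ ⟨q, rfl⟩ _ ⟨r, rfl⟩ hqr ⟨h1, h2⟩
  obtain ⟨k, hk⟩ := h q
  obtain ⟨m, hm, hm'⟩ := (frequently_atTop.1 h1) k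
  obtain ⟨n, hn, hn'⟩ := (frequently_atTop.1 h2) k
  have := (hk n hn).2 ((hk m hm).1 hm'.le)
  linarith

variable {f : X → ℝ}

lemma IsCoordinate.ae_eq_id (hf : IsCoordinate μ f) {ζ : X → X}
    (hζ : Measure.QuasiMeasurePreserving ζ μ μ)
    (h : ∀ q : ℚ, ζ ⁻¹' (f ⁻¹' Set.Iic q) =ᵐ[μ] f ⁻¹' Set.Iic (q : ℝ)) : ∀ᵐ x ∂μ, ζ x = x := by
  obtain ⟨X₀, h0, hinj⟩ := hf.injOn
  have hX₀ : ∀ᵐ x ∂μ, x ∈ X₀ := h0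
  filter_upwards [hX₀, hζ.ae hX₀, ae_all_iff.2 h] with x h1 h2 h3
  have h3 : ∀ q : ℚ, f (ζ x) ≤ q ↔ f x ≤ q := fun q => iff_of_eq (h3 q)
  exact hinj h2 h1 (eq_of_forall_rat_lt_iff_lt fun q => by rw [← not_le, ← not_le, h3 q])

variable [IsProbabilityMeasure μ]

/-- A sequence of measure preserving maps whose preimages of the sublevel sets of a coordinate
stabilize has a limit. -/
lemma IsCoordinate.exists_limit (hf : IsCoordinate μ f) {M : ℝ} (hM : ∀ x, |f x| ≤ M)
    {φ : ℕ → X → X} (hφ : ∀ n, MeasurePreserving (φ n) μ μ)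
    (hstab : ∀ q : ℚ, ∃ k, ∀ m ≥ k, φ m ⁻¹' (f ⁻¹' Set.Iic q) = φ k ⁻¹' (f ⁻¹' Set.Iic q)) :
    ∃ θ, MeasurePreserving θ μ μ ∧ ∀ A k, MeasurableSet A → (∀ m ≥ k, φ m ⁻¹' A = φ k ⁻¹' A) →
      θ ⁻¹' A =ᵐ[μ] φ k ⁻¹' A := by
  have hlim : ∀ x, ∃ l, Tendsto (fun n => f (φ n x)) atTop (𝓝 l) := by
    intro x
    refine tendsto_of_forall_rat (fun n => hM _) fun q => ?_
    obtain ⟨k, hk⟩ := hstab q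
    exact ⟨k, fun m hm => Set.ext_iff.1 (hk m hm) x⟩
  choose h hh using hlim
  have hfφ : ∀ n, Measurable fun x => f (φ n x) := fun n =>
    hf.measurable.comp (hφ n).measurable
  have hhm : Measurable h := measurable_of_tendsto_metrizable hfφ (tendsto_pi_nhds.2 hh)
  have hlawφ : ∀ n, μ.map (fun x => f (φ n x)) = μ.map f := by
    intro n
    have := Measure.map_map (μ := μ) hf.measurable (hφ n).measurable
    rw [(hφ n).map_eq] at this
    exact this.symm
  have hcont : ∀ u : BoundedContinuousFunction ℝ ℝ, ∀ n,
      ∫ x, u (f (φ n x)) ∂μ = ∫ y, u y ∂(μ.map f) := by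
    intro u n
    rw [← hlawφ n, integral_map (hfφ n).aemeasurable u.continuous.aestronglyMeasurable]
  have : IsProbabilityMeasure (μ.map f) :=
    Measure.isProbabilityMeasure_map hf.measurable.aemeasurable
  have : IsProbabilityMeasure (μ.map h) := Measure.isProbabilityMeasure_map hhm.aemeasurable
  -- Every f ∘ φ n has the law of f, and pointwise convergence passes this law to h.
  have hlaw : μ.map h = μ.map f := by
    refine ext_of_forall_integral_eq_of_IsFiniteMeasure fun u => ?_
    rw [integral_map hhm.aemeasurable u.continuous.aestronglyMeasurable]
    have ht : Tendsto (fun n => ∫ x, u (f (φ n x)) ∂μ) atTop (𝓝 (∫ x, u (h x) ∂μ)) := by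
      refine tendsto_integral_of_dominated_convergence (fun _ => ‖u‖)
        (fun n => (u.continuous.measurable.comp (hfφ n)).aestronglyMeasurable)
        (integrable_const _) (fun n => Eventually.of_forall fun x => u.norm_coe_le_norm _)
        (Eventually.of_forall fun x => (u.continuous.tendsto _).comp (hh x))
    simp only [hcont] at ht
    exact tendsto_nhds_unique ht tendsto_const_nhds |>.symm ▸ rfl
  obtain ⟨θ, hθ, hfθ⟩ := hf.exists_lift h hhm hlaw
  refine ⟨θ, hθ, fun A k hA hk => ?_⟩
  obtain ⟨W, hW, hAW⟩ := hf.exists_preimage A hA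
  rw [← measure_symmDiff_eq_zero_iff]
  -- Approximate the indicator of W by a continuous u in L¹ of the common law. This costs ε for h
  -- and ε for f ∘ φ m alike, and u(f ∘ φ m) tends to u(h) in L¹.
  have hle : ∀ ε > 0, μ.real ((θ ⁻¹' A) ∆ (φ k ⁻¹' A)) ≤ ε + ε := by
    intro ε hε
    obtain ⟨u, hu, hui⟩ := Integrable.exists_boundedContinuous_integral_sub_le
      (μ := μ.map f) (f := W.indicator (1 : ℝ → ℝ)) ((integrable_const (1 : ℝ)).indicator hW) hε
    let g : ℝ → ℝ := fun y => ‖W.indicator (1 : ℝ → ℝ) y - u y‖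
    have hgi : Integrable g (μ.map f) :=
      (((integrable_const (1 : ℝ)).indicator hW).sub hui).norm
    have hg : ∀ {ℓ : X → ℝ}, Measurable ℓ → μ.map ℓ = μ.map f →
        Integrable (fun x => g (ℓ x)) μ ∧ ∫ x, g (ℓ x) ∂μ ≤ ε := by
      intro ℓ hℓ hmap
      rw [← hmap] at hgi hu
      refine ⟨hgi.comp_measurable hℓ, ?_⟩
      rwa [integral_map hℓ.aemeasurable hgi.aestronglyMeasurable] at hu
    have hui : ∀ {ℓ : X → ℝ}, Measurable ℓ → Integrable (fun x => u (ℓ x)) μ := fun hℓ =>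
      Integrable.of_bound (u.continuous.measurable.comp hℓ).aestronglyMeasurable ‖u‖
        (Eventually.of_forall fun x => u.norm_coe_le_norm _)
    have hdi : ∀ m, Integrable (fun x => ‖u (h x) - u (f (φ m x))‖) μ := fun m =>
      ((hui hhm).sub (hui (hfφ m))).norm
    have hbound : ∀ m ≥ k, μ.real ((θ ⁻¹' A) ∆ (φ k ⁻¹' A)) ≤
        ε + ∫ x, ‖u (h x) - u (f (φ m x))‖ ∂μ + ε := by
      intro m hm
      have hset : ((θ ⁻¹' A) ∆ (φ k ⁻¹' A) : Set X) =ᵐ[μ]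
          ((h ⁻¹' W) ∆ ((fun x => f (φ m x)) ⁻¹' W) : Set X) := by
        rw [← hk m hm]
        have h1 := hθ.quasiMeasurePreserving.ae hAW
        have h2 := (hφ m).quasiMeasurePreserving.ae hAW
        filter_upwards [h1, h2, hfθ] with x h1 h2 h3
        have h1 : (θ x ∈ A) = (f (θ x) ∈ W) := h1
        have h2 : (φ m x ∈ A) = (f (φ m x) ∈ W) := h2
        refine propext ?_
        change x ∈ (θ ⁻¹' A) ∆ (φ m ⁻¹' A) ↔ x ∈ (h ⁻¹' W) ∆ ((fun x => f (φ m x)) ⁻¹' W)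
        simp only [Set.mem_symmDiff, Set.mem_preimage, h1, h2, h3]
      have hDm : MeasurableSet ((h ⁻¹' W) ∆ ((fun x => f (φ m x)) ⁻¹' W) : Set X) :=
        (hhm hW).symmDiff (hfφ m hW)
      obtain ⟨i1, l1⟩ := hg hhm hlaw
      obtain ⟨i2, l2⟩ := hg (hfφ m) (hlawφ m)
      rw [measureReal_congr hset, ← integral_indicator_one hDm]
      have i12 : Integrable (fun x => g (h x) + ‖u (h x) - u (f (φ m x))‖) μ := i1.add (hdi m)
      have hmono : ∫ x, ((h ⁻¹' W) ∆ ((fun x => f (φ m x)) ⁻¹' W)).indicator (1 : X → ℝ) x ∂μ ≤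
          ∫ x, (g (h x) + ‖u (h x) - u (f (φ m x))‖) + g (f (φ m x)) ∂μ := by
        refine integral_mono ((integrable_const (1 : ℝ)).indicator hDm) (i12.add i2) fun x => ?_
        have hx : ((h ⁻¹' W) ∆ ((fun x => f (φ m x)) ⁻¹' W)).indicator (1 : X → ℝ) x ≤
            ‖W.indicator (1 : ℝ → ℝ) (h x) - W.indicator (1 : ℝ → ℝ) (f (φ m x))‖ := by
          by_cases a : h x ∈ W <;> by_cases b : f (φ m x) ∈ W <;>
            simp [Set.indicator, Set.mem_symmDiff, a, b]
        refine hx.trans ?_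
        simp only [g, Real.norm_eq_abs]
        have t1 := abs_sub_le (W.indicator (1 : ℝ → ℝ) (h x)) (u (h x))
          (W.indicator (1 : ℝ → ℝ) (f (φ m x)))
        have t2 := abs_sub_le (u (h x)) (u (f (φ m x))) (W.indicator (1 : ℝ → ℝ) (f (φ m x)))
        rw [abs_sub_comm (u (f (φ m x)))] at t2
        linarith
      rw [integral_add i12 i2, integral_add i1 (hdi m)] at hmono
      linarith
    have ht : Tendsto (fun m => ∫ x, ‖u (h x) - u (f (φ m x))‖ ∂μ) atTop
        (𝓝 (∫ _x, (0 : ℝ) ∂μ)) := by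
      refine tendsto_integral_of_dominated_convergence (fun _ => ‖u‖ + ‖u‖)
        (fun n => (hdi n).aestronglyMeasurable) (integrable_const _)
        (fun n => Eventually.of_forall fun x => ?_) (Eventually.of_forall fun x => ?_)
      · rw [norm_norm]
        exact (norm_sub_le _ _).trans (add_le_add (u.norm_coe_le_norm _) (u.norm_coe_le_norm _))
      · have := ((u.continuous.tendsto _).comp (hh x)).const_sub (u (h x))
        have := this.norm
        simpa using this
    rw [integral_zero] at ht
    have ht2 := (ht.const_add ε).add_const ε
    rw [add_zero] at ht2
    exact ge_of_tendsto ht2 ((eventually_ge_atTop k).mono hbound)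
  have h0 : μ.real ((θ ⁻¹' A) ∆ (φ k ⁻¹' A)) ≤ 0 :=
    le_of_forall_pos_le_add fun ε hε => by
      have := hle (ε / 2) (half_pos hε)
      linarith
  exact (measureReal_eq_zero_iff).1 (le_antisymm h0 measureReal_nonneg)

/-- A sequence of automorphisms whose images and preimages of the sublevel sets of a coordinate
stabilize has a limit automorphism. -/
lemma IsCoordinate.exists_limit_automorphism (hf : IsCoordinate μ f) {M : ℝ}
    (hM : ∀ x, |f x| ≤ M) {φ : ℕ → Automorphisms μ}
    (hstab : ∀ q : ℚ, ∃ k, ∀ m ≥ k,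
      (φ m).1.symm ⁻¹' (f ⁻¹' Set.Iic q) = (φ k).1.symm ⁻¹' (f ⁻¹' Set.Iic q) ∧
      (φ m).1 ⁻¹' (f ⁻¹' Set.Iic q) = (φ k).1 ⁻¹' (f ⁻¹' Set.Iic q)) :
    ∃ ψ : Automorphisms μ, ∀ A k, MeasurableSet A →
      (∀ m ≥ k, (φ m).1.symm ⁻¹' A = (φ k).1.symm ⁻¹' A) →
      ψ.1.symm ⁻¹' A =ᵐ[μ] (φ k).1.symm ⁻¹' A := by
  obtain ⟨θ, hθ, hθA⟩ := hf.exists_limit hM (φ := fun n => (φ n).1) (fun n => (φ n).2)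
    fun q => (hstab q).imp fun k hk m hm => (hk m hm).2
  obtain ⟨θ', hθ', hθA'⟩ := hf.exists_limit hM (φ := fun n => (φ n).1.symm)
    (fun n => (φ n).2.symm (φ n).1) fun q => (hstab q).imp fun k hk m hm => (hk m hm).1
  have hQ : ∀ q : ℚ, MeasurableSet (f ⁻¹' Set.Iic (q : ℝ)) := fun q =>
    hf.measurable measurableSet_Iic
  have hback : ∀ (ψ : Automorphisms μ) (A : Set X), ψ.1.symm ⁻¹' (ψ.1 ⁻¹' A) = A := by
    intro ψ A
    ext x
    simp
  have hback' : ∀ (ψ : Automorphisms μ) (A : Set X), ψ.1 ⁻¹' (ψ.1.symm ⁻¹' A) = A := by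
    intro ψ A
    ext x
    simp
  have h1 : ∀ᵐ x ∂μ, θ (θ' x) = x := by
    refine hf.ae_eq_id (hθ.comp hθ').quasiMeasurePreserving fun q => ?_
    obtain ⟨k, hk⟩ := hstab q
    have e1 := hθA _ k (hQ q) fun m hm => (hk m hm).2
    -- The preimage of a sublevel set under φ k is again stable: for m ≥ k it is also the preimage
    -- under φ m, so φ m sends it back to the sublevel set.
    have e2 := hθA' ((φ k).1 ⁻¹' (f ⁻¹' Set.Iic (q : ℝ))) k ((φ k).1.measurable (hQ q))
      fun m hm => by rw [← (hk m hm).2, hback, (hk m hm).2, hback]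
    rw [hback] at e2
    exact (hθ'.quasiMeasurePreserving.preimage_ae_eq e1).trans e2
  have h2 : ∀ᵐ x ∂μ, θ' (θ x) = x := by
    refine hf.ae_eq_id (hθ'.comp hθ).quasiMeasurePreserving fun q => ?_
    obtain ⟨k, hk⟩ := hstab q
    have e1 := hθA' _ k (hQ q) fun m hm => (hk m hm).1
    have e2 := hθA ((φ k).1.symm ⁻¹' (f ⁻¹' Set.Iic (q : ℝ))) k
      ((φ k).1.symm.measurable (hQ q))
      fun m hm => by rw [← (hk m hm).1, hback', (hk m hm).1, hback']
    rw [hback'] at e2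
    exact (hθ.quasiMeasurePreserving.preimage_ae_eq e1).trans e2
  obtain ⟨ψ, -, hψ⟩ := exists_automorphism_ae_eq hθ hθ' h1 h2
  refine ⟨ψ, fun A k hA hk => ?_⟩
  refine EventuallyEq.trans ?_ (hθA' A k hA hk)
  filter_upwards [hψ] with x hx
  exact congrArg (fun y => y ∈ A) hx

end UniformMixing

/-! ### Conjugation, the weak topology and density -/

namespace UniformMixing

variable {X : Type*} [MeasurableSpace X] {μ : Measure X}

lemma iterate_ae_eq {T τ : X → X} (hT : MeasurePreserving T μ μ) (h : T =ᵐ[μ] τ) (i : ℕ) :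
    T^[i] =ᵐ[μ] τ^[i] := by
  induction i with
  | zero => rfl
  | succ i ih =>
    rw [Function.iterate_succ', Function.iterate_succ']
    filter_upwards [ih, (hT.iterate i).quasiMeasurePreserving.ae h] with x h1 h2
    simp only [Function.comp_apply]
    rw [h2, h1]

lemma mixingAverage_congr_map {T τ : X → X} (hT : MeasurePreserving T μ μ) (h : T =ᵐ[μ] τ)
    (A B : Set X) (n : ℕ) : mixingAverage μ T A B n = mixingAverage μ τ A B n := by
  rw [mixingAverage, mixingAverage]
  congr 1
  refine Finset.sum_congr rfl fun i _ => ?_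
  have : (A ∩ T^[i] ⁻¹' B : Set X) =ᵐ[μ] (A ∩ τ^[i] ⁻¹' B : Set X) := by
    filter_upwards [iterate_ae_eq hT h i] with x hx
    refine propext (and_congr_right fun _ => ?_)
    change T^[i] x ∈ B ↔ τ^[i] x ∈ B
    rw [hx]
  rw [measureReal_congr this]

lemma IsWeakMixing.congr {T : X → X} (hT : IsWeakMixing μ T) {τ : Automorphisms μ}
    (h : T =ᵐ[μ] τ.1) : IsWeakMixing μ τ.1 where
  measurePreserving := τ.2
  tendsto_mixingAverage A B hA hB := by
    refine (hT.tendsto_mixingAverage A B hA hB).congr fun n => ?_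
    exact mixingAverage_congr_map hT.measurePreserving h A B n

lemma iterate_conjugate (T : X → X) (φ : Automorphisms μ) (i : ℕ) :
    (conjugate T φ)^[i] = φ.1.symm ∘ T^[i] ∘ φ.1 := by
  induction i with
  | zero =>
    funext x
    simp
  | succ i ih =>
    rw [Function.iterate_succ', Function.iterate_succ', ih]
    funext x
    simp [conjugate]

lemma mixingAverage_conjugate {T : X → X} (hT : Measurable T) (φ : Automorphisms μ) {C : Set X}
    (hC : MeasurableSet C) (n : ℕ) : mixingAverage μ (conjugate T φ) C C n =
      mixingAverage μ T (φ.1.symm ⁻¹' C) (φ.1.symm ⁻¹' C) n := by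
  rw [mixingAverage, mixingAverage]
  congr 1
  refine Finset.sum_congr rfl fun i _ => ?_
  have hm : MeasurableSet (φ.1.symm ⁻¹' C) := φ.1.symm.measurable hC
  rw [((φ.2.symm φ.1).measureReal_preimage hC.nullMeasurableSet),
    ← φ.2.measureReal_preimage (hm.inter (hT.iterate i hm)).nullMeasurableSet,
    iterate_conjugate]
  have : φ.1 ⁻¹' (φ.1.symm ⁻¹' C ∩ T^[i] ⁻¹' (φ.1.symm ⁻¹' C)) =
      C ∩ (φ.1.symm ∘ T^[i] ∘ φ.1) ⁻¹' C := by
    ext x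
    simp
  rw [this]

variable [IsProbabilityMeasure μ]

/-- The weak topology makes φ ↦ φC continuous by definition, and the mixing average is 4-Lipschitz
in the set. -/
lemma continuous_mixingAverage {T : X → X} (hT : MeasurePreserving T μ μ) {C : Set X}
    (hC : MeasurableSet C) (n : ℕ) : Continuous fun φ : Automorphisms μ =>
      mixingAverage μ T (φ.1.symm ⁻¹' C) (φ.1.symm ⁻¹' C) n := by
  have h1 : Continuous fun φ : Automorphisms μ => φ.image ⟨C, hC⟩ :=
    (continuous_apply (A := fun _ => MeasuredSets μ)
      (⟨C, hC⟩ : {A : Set X // MeasurableSet A})).comp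
      (continuous_induced_dom (f := Automorphisms.image))
  have h2 : LipschitzWith 4 fun A : MeasuredSets μ => mixingAverage μ T A A n := by
    refine LipschitzWith.of_le_add_mul 4 fun A B => ?_
    have := mixingAverage_le_add A.2 A.2 B.2 B.2 hT n
    rw [MeasuredSets.dist_def]
    refine this.trans (le_of_eq ?_)
    push_cast
    change mixingAverage μ T B B n + 2 * (μ.real ((A : Set X) ∆ B) + μ.real ((A : Set X) ∆ B)) =
      mixingAverage μ T B B n + 4 * μ.real ((A : Set X) ∆ B)
    ring
  refine (h2.continuous.comp h1).congr fun φ => ?_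
  have : ((φ.image ⟨C, hC⟩ : MeasuredSets μ) : Set X) = φ.1.symm ⁻¹' C :=
    φ.1.toEquiv.image_eq_preimage_symm C
  simp only [Function.comp_apply, this]

lemma isGδ_setOf_badly_mixing {T : X → X} (hT : MeasurePreserving T μ μ) {𝒞 : Set (Set X)}
    (h𝒞 : ∀ C ∈ 𝒞, MeasurableSet C) (c : ℝ) :
    IsGδ {φ : Automorphisms μ | ∀ N : ℕ, ∃ n ≥ N, ∃ C ∈ 𝒞,
      c < mixingAverage μ T (φ.1.symm ⁻¹' C) (φ.1.symm ⁻¹' C) n} := by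
  have : {φ : Automorphisms μ | ∀ N : ℕ, ∃ n ≥ N, ∃ C ∈ 𝒞,
      c < mixingAverage μ T (φ.1.symm ⁻¹' C) (φ.1.symm ⁻¹' C) n} =
      ⋂ N : ℕ, ⋃ n ≥ N, ⋃ C ∈ 𝒞, {φ : Automorphisms μ |
        c < mixingAverage μ T (φ.1.symm ⁻¹' C) (φ.1.symm ⁻¹' C) n} := by
    ext φ
    simp
  rw [this]
  exact IsGδ.iInter fun N => IsOpen.isGδ <| isOpen_iUnion fun n => isOpen_iUnion fun _ =>
    isOpen_iUnion fun C => isOpen_iUnion fun hC =>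
      isOpen_lt continuous_const (continuous_mixingAverage hT (h𝒞 C hC) n)

/-- Density in the weak topology is tested on the images of finitely many sets. -/
lemma dense_of_forall_finite {G : Set (Automorphisms μ)}
    (h : ∀ (φ : Automorphisms μ) (L : List (Set X)), (∀ A ∈ L, MeasurableSet A) →
      ∃ ψ ∈ G, ∀ A ∈ L, ψ.1.symm ⁻¹' A =ᵐ[μ] φ.1.symm ⁻¹' A) : Dense G := by
  intro φ
  rw [mem_closure_iff_nhds]
  intro U hU
  rw [nhds_induced, mem_comap] at hU
  obtain ⟨V, hV, hVU⟩ := hU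
  rw [nhds_pi, mem_pi] at hV
  obtain ⟨I, hI, t, ht, htV⟩ := hV
  obtain ⟨ψ, hψG, hψ⟩ := h φ (hI.toFinset.toList.map Subtype.val) (by
    intro A hA
    obtain ⟨A, -, rfl⟩ := List.mem_map.1 hA
    exact A.2)
  refine ⟨ψ, hVU (htV fun A hA => ?_), hψG⟩
  have hA' := hψ A (List.mem_map_of_mem (by simpa using hA))
  have himg : ∀ φ : Automorphisms μ, ((φ.image A : MeasuredSets μ) : Set X) =
      φ.1.symm ⁻¹' (A : Set X) := fun φ => φ.1.toEquiv.image_eq_preimage_symm _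
  -- Sets that agree almost everywhere are at distance zero, hence have the same neighbourhoods.
  have hins : Inseparable (φ.image A) (ψ.image A) := by
    rw [EMetric.inseparable_iff, MeasuredSets.edist_def, himg, himg]
    exact measure_symmDiff_eq_zero_iff.2 hA'.symm
  have := ht A
  rw [hins.nhds_eq] at this
  exact mem_of_mem_nhds this

/-- The automorphisms under which the images of a non-approximable family do not mix uniformly
are dense. -/
lemma dense_setOf_badly_mixing {τ : Automorphisms μ} (hτ : IsWeakMixing μ τ.1)
    (hsmall : ∀ ε > 0, ∃ A, MeasurableSet A ∧ 0 < μ.real A ∧ μ.real A < ε) {f : X → ℝ}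
    (hf : IsCoordinate μ f) {M : ℝ} (hM : ∀ x, |f x| ≤ M) {K : Set X}
    (hK : MeasurableSet K) {κ : ℝ} (hκ0 : 0 < κ) (hκ : κ ≤ μ.real K) (hκ' : κ ≤ 1 - μ.real K)
    {𝒞 : Set (Set X)} (h𝒞 : ∀ C ∈ 𝒞, MeasurableSet C) {c : ℝ}
    (hc : 0 < c) (h : ∀ m (B : Fin m → Set X), (∀ i, MeasurableSet (B i)) →
      ∃ C ∈ 𝒞, c ≤ splitSize μ (joinCell B) C) {r : ℝ} (hr : r < (κ * c / 4) ^ 2 / 2) :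
    Dense {φ : Automorphisms μ | ∀ N : ℕ, ∃ n ≥ N, ∃ C ∈ 𝒞,
      r < mixingAverage μ τ.1 (φ.1.symm ⁻¹' C) (φ.1.symm ⁻¹' C) n} := by
  refine dense_of_forall_finite fun φ₀ L₀ hL₀ => ?_
  obtain ⟨q, hq⟩ := exists_surjective_nat ℚ
  have hQ : ∀ q : ℚ, MeasurableSet (f ⁻¹' Set.Iic (q : ℝ)) := fun q =>
    hf.measurable measurableSet_Iic
  -- A state is an automorphism with the sets whose images and preimages are frozen from then on.
  -- Step k freezes the k-th rational sublevel set, for convergence, and a member that mixes badly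
  -- at time k + 1, so that this survives in the limit.
  let State := Automorphisms μ × {L : List (Set X) // ∀ A ∈ L, MeasurableSet A}
  have hstep : ∀ (k : ℕ) (s : State), ∃ s' : State, (∀ A ∈ s.2.1, A ∈ s'.2.1) ∧
      f ⁻¹' Set.Iic (q k : ℝ) ∈ s'.2.1 ∧
      (∃ C ∈ 𝒞, C ∈ s'.2.1 ∧ (κ * c / 4) ^ 2 / 2 ≤
        mixingAverage μ τ.1 (s'.1.1.symm ⁻¹' C) (s'.1.1.symm ⁻¹' C) (k + 1)) ∧
      ∀ A ∈ s.2.1, s'.1.1.symm ⁻¹' A = s.1.1.symm ⁻¹' A ∧ s'.1.1 ⁻¹' A = s.1.1 ⁻¹' A := by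
    intro k s
    obtain ⟨φ', C, hC, hA, hmix⟩ := exists_modification hτ hsmall hK hκ0 hκ hκ' h𝒞 hc h s.1
      s.2.2 (Nat.succ_pos k)
    refine ⟨⟨φ', C :: f ⁻¹' Set.Iic (q k : ℝ) :: s.2.1, ?_⟩, ?_, ?_, ⟨C, hC, ?_, hmix⟩, hA⟩
    · intro A hA
      rcases List.mem_cons.1 hA with rfl | hA
      · exact h𝒞 _ hC
      rcases List.mem_cons.1 hA with rfl | hA
      exacts [hQ _, s.2.2 _ hA]
    · exact fun A hA => List.mem_cons_of_mem _ (List.mem_cons_of_mem _ hA)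
    · exact List.mem_cons_of_mem _ List.mem_cons_self
    · exact List.mem_cons_self
  choose next hsub hrat hmem hstab using hstep
  let s : ℕ → State := Nat.rec ⟨φ₀, L₀, hL₀⟩ next
  have hs : ∀ k, s (k + 1) = next k (s k) := fun k => rfl
  have hstable : ∀ k, ∀ A ∈ (s k).2.1, ∀ m ≥ k, A ∈ (s m).2.1 ∧
      (s m).1.1.symm ⁻¹' A = (s k).1.1.symm ⁻¹' A ∧ (s m).1.1 ⁻¹' A = (s k).1.1 ⁻¹' A := by
    intro k A hA m hm
    induction m, hm using Nat.le_induction with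
    | base => exact ⟨hA, rfl, rfl⟩
    | succ m _ ih =>
      obtain ⟨h1, h2, h3⟩ := ih
      obtain ⟨h4, h5⟩ := hstab m (s m) A h1
      rw [hs]
      exact ⟨hsub m _ A h1, h4.trans h2, h5.trans h3⟩
  obtain ⟨ψ, hψ⟩ := hf.exists_limit_automorphism hM (φ := fun k => (s k).1) fun p => by
    obtain ⟨k, rfl⟩ := hq p
    exact ⟨k + 1, fun m hm => (hstable (k + 1) _ (hrat k (s k)) m hm).2⟩
  have hψL : ∀ k, ∀ A ∈ (s k).2.1, ψ.1.symm ⁻¹' A =ᵐ[μ] (s k).1.1.symm ⁻¹' A := fun k A hA =>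
    hψ A k ((s k).2.2 A hA) fun m hm => (hstable k A hA m hm).2.1
  refine ⟨ψ, fun N => ?_, fun A hA => hψL 0 A hA⟩
  obtain ⟨C, hC, hCs, hmix⟩ := hmem N (s N)
  refine ⟨N + 1, Nat.le_succ N, C, hC, hr.trans_le (hmix.trans ?_)⟩
  have hae := measure_symmDiff_eq_zero_iff.2 (hψL (N + 1) C hCs).symm
  have hCm := h𝒞 C hC
  have := mixingAverage_le_add ((s (N + 1)).1.1.symm.measurable hCm)
    ((s (N + 1)).1.1.symm.measurable hCm) (ψ.1.symm.measurable hCm) (ψ.1.symm.measurable hCm)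
    hτ.measurePreserving (N + 1)
  rw [measureReal_def, hae] at this
  simpa using this

end UniformMixing

/-! ### The corollary -/

theorem corollary4p1 {X : Type*} [MeasurableSpace X] (μ : Measure X) [IsProbabilityMeasure μ]
    (T : X → X) (hT : UniformMixing.IsWeakMixing μ T)
    (𝒞 : Set (Set X)) (h𝒞 : ∀ C ∈ 𝒞, MeasurableSet C) :
    (UniformMixing.familyEntropy μ 𝒞 = 0 →
      Tendsto (fun n : ℕ => ⨆ p : 𝒞 × 𝒞, UniformMixing.mixingAverage μ T p.1 p.2 n)
        atTop (𝓝 0)) ∧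
    (UniformMixing.IsInvertible μ T → UniformMixing.IsLebesgueSpace μ →
      0 < UniformMixing.familyEntropy μ 𝒞 →
      ∃ G : Set (UniformMixing.Automorphisms μ), Dense G ∧ IsGδ G ∧ ∀ φ ∈ G,
        0 < limsup (fun n : ℕ =>
          ⨆ C : 𝒞, UniformMixing.mixingAverage μ (UniformMixing.conjugate T φ) C C n) atTop) := by
  refine ⟨hT.tendsto_iSup_mixingAverage h𝒞, ?_⟩
  rintro ⟨τ, hTτ⟩ hL hpos
  have hτ := hT.congr hTτ
  obtain ⟨c, hc, hsplit⟩ := UniformMixing.exists_splitSize_of_familyEntropy_pos h𝒞 hpos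
  have hsmall : ∀ ε > 0, ∃ A, MeasurableSet A ∧ 0 < μ.real A ∧ μ.real A < ε := fun ε hε =>
    UniformMixing.exists_small_of_familyEntropy_pos h𝒞 hpos hε
  obtain ⟨f, hf⟩ := hL.exists_isCoordinate
  obtain ⟨K, hK, hK0, hK1⟩ := hsmall 1 one_pos
  set κ := min (μ.real K) (1 - μ.real K) with hκ
  have hκ0 : 0 < κ := lt_min hK0 (sub_pos.2 hK1)
  -- Half of the bound achieved by the construction, so that the strict inequality defining the open
  -- sets holds.
  set r := (κ * c / 4) ^ 2 / 2 / 2 with hr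
  have hr0 : 0 < r := by positivity
  have hr1 : r < (κ * c / 4) ^ 2 / 2 := half_lt_self (by positivity)
  refine ⟨_, UniformMixing.dense_setOf_badly_mixing hτ hsmall hf.arctan (M := Real.pi / 2)
    (fun x => abs_le.2 ⟨(Real.neg_pi_div_two_lt_arctan _).le, (Real.arctan_lt_pi_div_two _).le⟩)
    hK hκ0 (min_le_left _ _) (min_le_right _ _) h𝒞 hc hsplit hr1,
    UniformMixing.isGδ_setOf_badly_mixing hτ.measurePreserving h𝒞 r, fun φ hφ => ?_⟩
  refine hr0.trans_le (le_limsup_of_frequently_le ?_ ?_)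
  · rw [frequently_atTop]
    intro N
    obtain ⟨n, hn, C, hC, hlt⟩ := hφ N
    refine ⟨n, hn, ?_⟩
    have hbdd : BddAbove (Set.range fun C : 𝒞 =>
        UniformMixing.mixingAverage μ (UniformMixing.conjugate T φ) C C n) :=
      ⟨1, by rintro _ ⟨C, rfl⟩; exact UniformMixing.mixingAverage_le_one _ _ _ _⟩
    refine le_trans ?_ (le_ciSup hbdd ⟨C, hC⟩)
    rw [UniformMixing.mixingAverage_conjugate hT.measurePreserving.measurable φ (h𝒞 C hC),
      UniformMixing.mixingAverage_congr_map hT.measurePreserving hTτ]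
    exact hlt.le
  · exact isBoundedUnder_of ⟨1, fun n => Real.iSup_le
      (fun C => UniformMixing.mixingAverage_le_one _ _ _ _) zero_le_one⟩
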